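/- **Setting.** Let $J\ge 1$, $\upsilon_{\max}>0$, $\sigma^*>0$. For odd $n$ and $t_i=2\pi(i-1)/n$ one observes $$Y_{i,j}=a_j^*f^*(t_i-\theta_j^*)+\upsilon_j^*+\sigma^*\varepsilon_{i,j},\qquad i=1,\dots,n,\ j=1,\dots,J,$$ where for each $n$ the $\varepsilon_{i,j}$ are independent standard Gaussian variables, $f^*:\mathbb R\to\mathbb R$ is continuous and $2\pi$-periodic with $\int_0^{2\pi}f^*(t)\,dt=0$, and $\beta^*=(\theta^*,a^*,\upsilon^*)$ lies in $$\mathcal A_0=\Big\{(\theta,a,\upsilon)\in[0,2\pi]^J\times\mathbb R^J\times[-\upsilon_{\max},\upsilon_{\max}]^J:\ \theta_1=0,\ \sum_{j=1}^Ja_j^2=J,\ a_1>0\Big\}.$$ Let $m_n$ be nonnegative integers with $2m_n<n$ and $m_n\to\infty$. For $\beta=(\theta,a,\upsilon)\in\mathcal A_0$ put $$\hat c_l(\beta)=\Big(n\sum_{j}a_j^2\Big)^{-1}\sum_{j=1}^Ja_j\sum_{i=1}^n(Y_{i,j}-\upsilon_j)e^{-il(t_i-\theta_j)},\qquad M_n(\beta)=\frac1{nJ}\sum_{j,i}(Y_{i,j}-\upsilon_j)^2-\sum_{1\le|l|\le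 m_n}|\hat c_l(\beta)|^2 .$$ Let $\hat\beta_n$ be an estimator which almost surely minimizes $M_n$ over $\mathcal A_0$, and let $\hat f_n(t)=\sum_{1\le|l|\le m_n}\hat c_l(\hat\beta_n)e^{ilt}$. All limits are for $n\to\infty$ along odd integers. Write $c_l(f)=\frac1{2\pi}\int_0^{2\pi}f(t)e^{-ilt}\,dt$ and $\mathrm{MISE}_{f^*}(\hat f_n)=\int_0^{2\pi}\mathbb E(\hat f_n(t)-f^*(t))^2\,dt$. **Statement.** Assume that $f^*$ is $k$ times continuously differentiable, $k\ge1$, with $\int_0^{2\pi}|f^{*(k)}(t)|^2\,dt<\infty$, that $f^*$ is not constant, that all $a_j^*$ are nonzero, and that $\sum_{l\in\mathbb Z}|l|\,|c_l(f^*)|<\infty$. Then there is a constant $C$, not depending on $n$ or on the sequence $(m_n)$, such that the following holds. 1. If $m_n^4/n\to0$, then $$\sup_{t\in\mathbb R}|\hat f_n(t)-f^*(t)|=O_{\mathbb P}\Big(\frac1{m_n^{k-1/2}}+\frac{m_n}{\sqrt n}\Big),$$ and, for all sufficiently large $n$, $$\int_0^{2\pi}\mathbb E\big(\hat f_n(t)-f^*(t)\big)^2\,dt\le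 C\Big(\frac1{m_n^{2k}}+\frac{m_n}{n}\Big).$$ 2. If $m_n$ is of exact order $n^{1/(2k+1)}$ (that is, $c\,n^{1/(2k+1)}\le m_n\le c'\,n^{1/(2k+1)}$ for large $n$ with constants $0<c\le c'$; in particular if $m_n\sim n^{1/(2k+1)}$), then $\mathrm{MISE}_{f^*}(\hat f_n)=O\big(n^{-2k/(2k+1)}\big)$. -/

import Mathlib

open MeasureTheory ProbabilityTheory Filter Topology Asymptotics
open scoped ENNReal

namespace ShapeInvariant

noncomputable section

/-- A finite-dimensional parameter `β = (θ, a, υ)`: shifts, scales and levels of the `J` curves. -/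
abbrev Param (J : ℕ) : Type := (Fin J → ℝ) × (Fin J → ℝ) × (Fin J → ℝ)

namespace Param

/-- The shift vector `θ`. -/
def shift {J : ℕ} (β : Param J) : Fin J → ℝ := β.1

/-- The scale vector `a`. -/
def scale {J : ℕ} (β : Param J) : Fin J → ℝ := β.2.1

/-- The level vector `υ`. -/
def level {J : ℕ} (β : Param J) : Fin J → ℝ := β.2.2

end Param

/-- The constrained parameter set: `θ ∈ [0, 2π]^J`, `υ ∈ [-υmax, υmax]^J`, the first shift is `0`,
`∑ a_j² = J`, and the first scale is positive. The first curve has index `0 : Fin J`. -/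
def paramSet (J : ℕ) [NeZero J] (υmax : ℝ) : Set (Param J) :=
  {β | (∀ j, β.shift j ∈ Set.Icc 0 (2 * Real.pi)) ∧ (∀ j, β.level j ∈ Set.Icc (-υmax) υmax) ∧
    β.shift 0 = 0 ∧ ∑ j, β.scale j ^ 2 = (J : ℝ) ∧ 0 < β.scale 0}

/-- The admissible shapes: continuous real `2π`-periodic functions with zero mean. -/
def shapeSet : Set (ℝ → ℝ) :=
  {f | Continuous f ∧ Function.Periodic f (2 * Real.pi) ∧ ∫ t in (0 : ℝ)..(2 * Real.pi), f t = 0}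

/-- The Fourier coefficient `c_l(f) = (1 / 2π) ∫_0^{2π} f(t) e^{-ilt} dt`. -/
def fourierCoef (f : ℝ → ℝ) (l : ℤ) : ℂ :=
  fourierCoeffOn Real.two_pi_pos (fun t => (f t : ℂ)) l

/-- The equidistant design `t_i = 2π (i - 1) / n`, `i = 1, …, n` (the index here starts at `0`). -/
def designPoint (n : ℕ) (i : Fin n) : ℝ := (i : ℝ) / (n : ℝ) * (2 * Real.pi)

/-- The data `Y_{i,j} = a_j f(t_i - θ_j) + υ_j + σ e_{i,j}`. -/
def observation {J : ℕ} (n : ℕ) (β : Param J) (f : ℝ → ℝ) (σ : ℝ) (e : Fin n → Fin J → ℝ) :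
    Fin n → Fin J → ℝ :=
  fun i j => β.scale j * f (designPoint n i - β.shift j) + β.level j + σ * e i j

/-- The frequencies `l ∈ ℤ` with `1 ≤ |l| ≤ m`. -/
def freqs (m : ℕ) : Finset ℤ := (Finset.Icc (-(m : ℤ)) (m : ℤ)).erase 0

/-- The estimated Fourier coefficient
`ĉ_l(β) = (n ∑_j a_j²)⁻¹ ∑_j a_j ∑_i (Y_{i,j} - υ_j) e^{-il(t_i - θ_j)}`. -/
def coefEst {J : ℕ} (n : ℕ) (Y : Fin n → Fin J → ℝ) (β : Param J) (l : ℤ) : ℂ :=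
  ((n : ℂ) * ∑ j, (β.scale j : ℂ) ^ 2)⁻¹ *
    ∑ j, (β.scale j : ℂ) * ∑ i, ((Y i j - β.level j : ℝ) : ℂ) *
      Complex.exp (-(Complex.I * (l : ℂ) * ((designPoint n i - β.shift j : ℝ) : ℂ)))

/-- The trigonometric polynomial `f̂_β(t) = ∑_{1 ≤ |l| ≤ m} ĉ_l(β) e^{ilt}`. Its values are real
since `ĉ_{-l}(β)` is the complex conjugate of `ĉ_l(β)`; they are kept here as complex numbers. -/
def shapeEst {J : ℕ} (n m : ℕ) (Y : Fin n → Fin J → ℝ) (β : Param J) (t : ℝ) : ℂ :=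
  ∑ l ∈ freqs m, coefEst n Y β l * Complex.exp (Complex.I * (l : ℂ) * (t : ℂ))

/-- The criterion
`M_n(β) = (nJ)⁻¹ ∑_j ∑_i (Y_{i,j} - υ_j)² - ∑_{1 ≤ |l| ≤ m} |ĉ_l(β)|²`. -/
def criterion {J : ℕ} (n m : ℕ) (Y : Fin n → Fin J → ℝ) (β : Param J) : ℝ :=
  ((n : ℝ) * (J : ℝ))⁻¹ * ∑ j, ∑ i, (Y i j - β.level j) ^ 2 -
    ∑ l ∈ freqs m, ‖coefEst n Y β l‖ ^ 2

/-- `b` is a minimizer of the criterion `M_n` over the constrained parameter set. -/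
def IsCriterionArgmin {J : ℕ} [NeZero J] (υmax : ℝ) (n m : ℕ) (Y : Fin n → Fin J → ℝ)
    (b : Param J) : Prop :=
  b ∈ paramSet J υmax ∧ IsMinOn (criterion n m Y) (paramSet J υmax) b

/-- The sample size `n` tends to infinity along the odd integers. -/
def oddAtTop : Filter ℕ := atTop ⊓ 𝓟 {n | Odd n}

/-- `X_n = O_P(r_n)` along the filter `F`, for random variables `X_n ≥ 0`: for every `δ > 0` there
is `K` such that `P(X_n > K r_n) ≤ δ` eventually. -/
def IsBigOInProb {Ω : Type*} [MeasurableSpace Ω] (F : Filter ℕ) (P : Measure Ω)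
    (X : ℕ → Ω → ℝ≥0∞) (r : ℕ → ℝ) : Prop :=
  ∀ δ : ℝ, 0 < δ → ∃ K : ℝ, 0 < K ∧
    ∀ᶠ n in F, P {ω | ENNReal.ofReal (K * r n) < X n ω} ≤ ENNReal.ofReal δ

/-- The uniform error `sup_{t ∈ ℝ} |g(t) - f(t)|`. -/
def supError (g : ℝ → ℂ) (f : ℝ → ℝ) : ℝ≥0∞ := ⨆ t : ℝ, ‖g t - (f t : ℂ)‖ₑ

/-- The mean integrated squared error `∫_0^{2π} E (g(t) - f(t))² dt` of a random function `g`. -/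
def mise {Ω : Type*} [MeasurableSpace Ω] (P : Measure Ω) (g : Ω → ℝ → ℂ) (f : ℝ → ℝ) : ℝ≥0∞ :=
  ∫⁻ t in Set.Icc 0 (2 * Real.pi), ∫⁻ ω, ‖g ω t - (f t : ℂ)‖ₑ ^ 2 ∂P

/-- The random function `f̂_n = f̂_{β̂_n}` computed from the data with true parameters `β`, `f`, `σ`
and noise `e`, with `m` frequencies and the parameter estimate `b`. -/
def shapeEstimator {Ω : Type*} {J : ℕ} (n m : ℕ) (β : Param J) (f : ℝ → ℝ) (σ : ℝ)
    (e : Fin n → Fin J → Ω → ℝ) (b : Ω → Param J) (ω : Ω) : ℝ → ℂ :=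
  shapeEst n m (observation n β f σ (fun i j => e i j ω)) (b ω)

end

end ShapeInvariant

open ShapeInvariant

/-! The error of the estimated Fourier coefficients is bounded pathwise by the error in the data, so
no consistency or rate for the estimated shifts and scales is needed.

On the equidistant design the levels do not affect frequencies `1 ≤ |l| ≤ m`, because `2 * m < n`
makes those characters sum to zero. Hence `coefEst` is a least-squares fit of the curves' discrete
coefficients along the directions `a_j e^{-ilθ_j}`, whose squared norm is `J` for every admissible
parameter. Minimizing the criterion makes the fitted energy at least that obtained at the true
shifts and scales, so by Pythagoras the residual of the minimizer is at most the energy `N` of the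
deviation from the true model. The fitted and true signals are then within `2√N` of each other.
Since every direction has norm `√J`, the norms of the two coefficient vectors are close. The first
curve is not shifted, so its row compares `b x` with `a y` for positive scales `b`, `a`. Together
these force `x` close to `y` (`sum_norm_sq_sub_le_of_fit`).

The energy `perturbation` has mean `O(m/n)`: Gaussian noise contributes `1/n` per coefficient, and
aliasing at most as much by summability of `|l| ‖c_l‖` (`lintegral_perturbation_le`). Parseval adds
the squared bias `O(m^{-2k})` and gives the integrated risk. For the uniform error, Cauchy–Schwarz
over the `2m` frequencies, a tail bound `O(m^{-(k-1/2)})` and Markov's inequality suffice. -/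

namespace ShapeInvariant

open ComplexConjugate

/-! ### Stability of least-squares fits when the directions vary -/

/-- The residual sum of squares of the fit `x` in the model with directions `u`, where `z` is the
least-squares fit. -/
theorem sum_norm_sq_sub_mul {ι : Type*} [Fintype ι] {r : ℝ} (hr : 0 < r) (u d : ι → ℂ)
    (hu : ∑ j, ‖u j‖ ^ 2 = r) (z x : ℂ) (hz : z = (r : ℂ)⁻¹ * ∑ j, conj (u j) * d j) :
    ∑ j, ‖d j - u j * x‖ ^ 2 = ∑ j, ‖d j‖ ^ 2 - r * ‖z‖ ^ 2 + r * ‖z - x‖ ^ 2 := by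
  have hz' : ∑ j, conj (u j) * d j = r * z := by
    rw [hz, mul_inv_cancel_left₀ (by exact_mod_cast hr.ne')]
  have h1 : ∀ j, ‖d j - u j * x‖ ^ 2 =
      ‖d j‖ ^ 2 - 2 * ((conj (u j) * d j) * conj x).re + ‖u j‖ ^ 2 * ‖x‖ ^ 2 := by
    intro j
    simp only [← Complex.normSq_eq_norm_sq, Complex.normSq_apply, Complex.sub_re, Complex.sub_im,
      Complex.mul_re, Complex.mul_im, Complex.conj_re, Complex.conj_im]
    ring
  simp only [h1, Finset.sum_add_distrib, Finset.sum_sub_distrib, ← Finset.mul_sum,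
    ← Finset.sum_mul, hu, ← Complex.re_sum, hz']
  simp only [← Complex.normSq_eq_norm_sq, Complex.normSq_apply, Complex.sub_re, Complex.sub_im,
    Complex.mul_re, Complex.mul_im, Complex.conj_re, Complex.conj_im, Complex.ofReal_re,
    Complex.ofReal_im]
  ring

theorem norm_sq_sub_le_two_mul {E : Type*} [SeminormedAddCommGroup E] (a b d : E) :
    ‖a - b‖ ^ 2 ≤ 2 * ‖d - a‖ ^ 2 + 2 * ‖d - b‖ ^ 2 := by
  have h : ‖a - b‖ ≤ ‖d - a‖ + ‖d - b‖ := by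
    have := norm_sub_le (d - b) (d - a)
    rw [sub_sub_sub_cancel_left] at this
    linarith
  nlinarith [norm_nonneg (a - b), sq_nonneg (‖d - a‖ - ‖d - b‖)]

/-- The fit `x` in the model with directions `v` is at distance at most a constant times the noise
`d - u y` from the truth `y` in the model with directions `u`, as soon as it explains the data `d`
at least as well as the best fit `z` with directions `u`, and some row of `u` and of `v` is constant
and positive, respectively nonnegative. -/
theorem sum_norm_sq_sub_le_of_fit {ι L : Type*} [Fintype ι] [Fintype L] {r a b : ℝ} (hr : 0 < r)
    (ha : 0 < a) (hb : 0 ≤ b) (u v d : ι → L → ℂ)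
    (hu : ∀ l, ∑ j, ‖u j l‖ ^ 2 = r) (hv : ∀ l, ∑ j, ‖v j l‖ ^ 2 = r) (x y z : L → ℂ)
    (hz : ∀ l, z l = (r : ℂ)⁻¹ * ∑ j, conj (u j l) * d j l)
    (hx : ∀ l, x l = (r : ℂ)⁻¹ * ∑ j, conj (v j l) * d j l)
    (hzx : ∑ l, ‖z l‖ ^ 2 ≤ ∑ l, ‖x l‖ ^ 2) (i : ι) (hui : ∀ l, u i l = a) (hvi : ∀ l, v i l = b) :
    ∑ l, ‖x l - y l‖ ^ 2 ≤
      ((4 + 2 * a / √r) / a) ^ 2 * ∑ l, ∑ j, ‖d j l - u j l * y l‖ ^ 2 := by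
  set N := ∑ l, ∑ j, ‖d j l - u j l * y l‖ ^ 2 with hN
  have hN0 : 0 ≤ N := by positivity
  -- Pythagoras for both sets of directions: a best fit leaves the data energy minus `r` times the
  -- fitted energy, and `x` has the larger fitted energy.
  have hfit : ∑ l, ∑ j, ‖d j l - v j l * x l‖ ^ 2 ≤ N := by
    have e1 : ∀ l, ∑ j, ‖d j l - v j l * x l‖ ^ 2 = ∑ j, ‖d j l‖ ^ 2 - r * ‖x l‖ ^ 2 := by
      intro l
      rw [sum_norm_sq_sub_mul hr (fun j => v j l) (fun j => d j l) (hv l) (x l) (x l) (hx l)]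
      simp
    have e2 : ∀ l, ∑ j, ‖d j l - u j l * y l‖ ^ 2 =
        ∑ j, ‖d j l‖ ^ 2 - r * ‖z l‖ ^ 2 + r * ‖z l - y l‖ ^ 2 := fun l =>
      sum_norm_sq_sub_mul hr (fun j => u j l) (fun j => d j l) (hu l) (z l) (y l) (hz l)
    have h0 : 0 ≤ r * ∑ l, ‖z l - y l‖ ^ 2 := by positivity
    rw [hN]
    simp only [e1, e2, Finset.sum_add_distrib, Finset.sum_sub_distrib, ← Finset.mul_sum]
    nlinarith
  -- `g` and `g'` are the fitted and the true signal. Both lie within `√N` of the data, and each has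
  -- norm `√r` times that of its coefficient vector.
  let g : EuclideanSpace ℂ (L × ι) := WithLp.toLp 2 fun p => v p.2 p.1 * x p.1
  let g' : EuclideanSpace ℂ (L × ι) := WithLp.toLp 2 fun p => u p.2 p.1 * y p.1
  let X : EuclideanSpace ℂ L := WithLp.toLp 2 x
  let Y : EuclideanSpace ℂ L := WithLp.toLp 2 y
  have hgg_sq : ‖g - g'‖ ^ 2 = ∑ l, ∑ j, ‖v j l * x l - u j l * y l‖ ^ 2 := by
    rw [EuclideanSpace.norm_sq_eq, Fintype.sum_prod_type]
    rfl
  have hgg_le : ‖g - g'‖ ^ 2 ≤ 4 * N := by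
    rw [hgg_sq]
    calc _ ≤ ∑ l, ∑ j, (2 * ‖d j l - v j l * x l‖ ^ 2 + 2 * ‖d j l - u j l * y l‖ ^ 2) :=
          Finset.sum_le_sum fun l _ => Finset.sum_le_sum fun j _ => norm_sq_sub_le_two_mul _ _ _
      _ ≤ 4 * N := by
          simp only [Finset.sum_add_distrib, ← Finset.mul_sum, ← hN]
          linarith
  have hgg : ‖g - g'‖ ≤ 2 * √N := by
    refine abs_le_of_sq_le_sq' ?_ (by positivity) |>.2
    rw [mul_pow, Real.sq_sqrt hN0]
    linarith
  have norm_embed : ∀ (w : ι → L → ℂ) (c : L → ℂ), (∀ l, ∑ j, ‖w j l‖ ^ 2 = r) →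
      ‖(WithLp.toLp 2 fun p => w p.2 p.1 * c p.1 : EuclideanSpace ℂ (L × ι))‖ =
        √r * ‖(WithLp.toLp 2 c : EuclideanSpace ℂ L)‖ := by
    intro w c hw
    rw [EuclideanSpace.norm_eq, EuclideanSpace.norm_eq, ← Real.sqrt_mul hr.le,
      Fintype.sum_prod_type]
    simp only [norm_mul, mul_pow, ← Finset.sum_mul, hw, Finset.mul_sum]
  have hgX : ‖g‖ = √r * ‖X‖ := norm_embed v x hv
  have hgY : ‖g'‖ = √r * ‖Y‖ := norm_embed u y hu
  have hsr : 0 < √r := Real.sqrt_pos.2 hr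
  have hXY : |‖Y‖ - ‖X‖| ≤ 2 * √N / √r := by
    rw [le_div_iff₀ hsr]
    calc |‖Y‖ - ‖X‖| * √r = |‖g'‖ - ‖g‖| := by
          rw [hgX, hgY, ← mul_sub, abs_mul, abs_of_pos hsr, mul_comm]
      _ ≤ ‖g' - g‖ := abs_norm_sub_norm_le _ _
      _ ≤ _ := by rw [norm_sub_rev]; exact hgg
  -- Row `i` alone, where both directions are constant in the frequency.
  have hrow : ‖(b : ℂ) • X - (a : ℂ) • Y‖ ≤ 2 * √N := by
    refine (abs_le_of_sq_le_sq' (?_ : _ ^ 2 ≤ ‖g - g'‖ ^ 2) (norm_nonneg _)).2.trans hgg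
    rw [hgg_sq, EuclideanSpace.norm_sq_eq]
    refine Finset.sum_le_sum fun l _ => ?_
    have := Finset.single_le_sum (f := fun j => ‖v j l * x l - u j l * y l‖ ^ 2)
      (fun j _ => by positivity) (Finset.mem_univ i)
    simpa [X, Y, hui, hvi] using this
  have hab : |b * ‖X‖ - a * ‖Y‖| ≤ 2 * √N := by
    refine le_trans ?_ hrow
    have := abs_norm_sub_norm_le ((b : ℂ) • X) ((a : ℂ) • Y)
    rwa [norm_smul, norm_smul, Complex.norm_real, Complex.norm_real, Real.norm_of_nonneg hb,
      Real.norm_of_nonneg ha.le] at this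
  -- The row compares `b‖X‖` with `a‖Y‖`; as `‖X‖` and `‖Y‖` are already close, the discrepancy
  -- between the scales is controlled where it matters, multiplied by `‖X‖`.
  have hba : |b - a| * ‖X‖ ≤ 2 * √N + a * (2 * √N / √r) := by
    calc |b - a| * ‖X‖ = |(b * ‖X‖ - a * ‖Y‖) + a * (‖Y‖ - ‖X‖)| := by
          rw [← abs_of_nonneg (norm_nonneg X), ← abs_mul, abs_of_nonneg (norm_nonneg X)]
          congr 1; ring
      _ ≤ |b * ‖X‖ - a * ‖Y‖| + a * |‖Y‖ - ‖X‖| := by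
          refine (abs_add_le _ _).trans ?_
          rw [abs_mul, abs_of_pos ha]
      _ ≤ _ := by gcongr
  have hdist : a * ‖X - Y‖ ≤ (4 + 2 * a / √r) * √N := by
    calc a * ‖X - Y‖ = ‖((b : ℂ) • X - (a : ℂ) • Y) - ((b : ℂ) - a) • X‖ := by
          rw [← Real.norm_of_nonneg ha.le, ← Complex.norm_real, ← norm_smul,
            Complex.norm_real, Real.norm_of_nonneg ha.le]
          congr 1; module
      _ ≤ 2 * √N + (2 * √N + a * (2 * √N / √r)) := by
          refine (norm_sub_le _ _).trans (add_le_add hrow ?_)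
          rw [norm_smul, ← Complex.ofReal_sub, Complex.norm_real]
          exact hba
      _ = _ := by ring
  have hfin : ‖X - Y‖ ≤ (4 + 2 * a / √r) / a * √N := by
    rw [div_mul_eq_mul_div, le_div_iff₀ ha]
    linarith
  calc ∑ l, ‖x l - y l‖ ^ 2 = ‖X - Y‖ ^ 2 := by
        rw [EuclideanSpace.norm_sq_eq]; rfl
    _ ≤ ((4 + 2 * a / √r) / a * √N) ^ 2 := by gcongr
    _ = _ := by rw [mul_pow, Real.sq_sqrt hN0]

/-! ### Fourier coefficients on `[0, 2π]`, derivatives and Parseval -/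

open Complex in
-- The period is kept as `2 * Real.pi - 0`, the form `b - a` in which `fourierCoeffOn` produces it.
theorem fourier_two_pi_apply (l : ℤ) (t : ℝ) :
    fourier l (t : AddCircle (2 * Real.pi - 0)) = exp (I * l * t) := by
  rw [fourier_coe_apply]
  congr 1
  have := Real.pi_ne_zero
  push_cast
  rw [sub_zero]
  field_simp

open Complex in
theorem norm_exp_I_int_mul (l : ℤ) (t : ℝ) : ‖exp (I * l * t)‖ = 1 := by
  have : I * l * t = ((l * t : ℝ) : ℂ) * I := by push_cast; ring
  rw [this, norm_exp_ofReal_mul_I]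

theorem norm_exp_neg_I_int_mul (l : ℤ) (t : ℝ) : ‖Complex.exp (-(Complex.I * l * t))‖ = 1 := by
  have := norm_exp_I_int_mul (-l) t
  push_cast at this
  rwa [mul_neg, neg_mul] at this

open Complex in
theorem fourierCoeffOn_two_pi (g : ℝ → ℂ) (l : ℤ) :
    fourierCoeffOn Real.two_pi_pos g l =
      (1 / (2 * Real.pi)) • ∫ t in (0 : ℝ)..2 * Real.pi, exp (I * (-l : ℤ) * t) * g t := by
  rw [fourierCoeffOn_eq_integral]
  simp only [fourier_two_pi_apply, sub_zero, smul_eq_mul]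

theorem fourierCoeffOn_two_pi_sub {g h : ℝ → ℂ} (hg : Continuous g) (hh : Continuous h) (l : ℤ) :
    fourierCoeffOn Real.two_pi_pos (fun t => g t - h t) l =
      fourierCoeffOn Real.two_pi_pos g l - fourierCoeffOn Real.two_pi_pos h l := by
  simp only [fourierCoeffOn_two_pi, mul_sub]
  rw [intervalIntegral.integral_sub, smul_sub] <;>
    exact Continuous.intervalIntegrable (by fun_prop) _ _

open Complex in
theorem fourierCoeffOn_two_pi_exp (q l : ℤ) :
    fourierCoeffOn Real.two_pi_pos (fun t : ℝ => exp (I * q * t)) l = if l = q then 1 else 0 := by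
  have : Fact (0 < 2 * Real.pi - 0) := ⟨by simpa using Real.pi_pos⟩
  have h := congrFun (fourierCoeff_fourier (T := 2 * Real.pi - 0) q) l
  rw [fourierCoeff_eq_intervalIntegral _ _ 0] at h
  rw [fourierCoeffOn_eq_integral]
  simp only [zero_add, ← fourier_two_pi_apply] at h ⊢
  rw [sub_zero] at h ⊢
  simpa [Pi.single_apply] using h

open Complex in
theorem fourierCoeffOn_two_pi_trigSum (s : Finset ℤ) (b : ℤ → ℂ) (l : ℤ) :
    fourierCoeffOn Real.two_pi_pos (fun t : ℝ => ∑ q ∈ s, b q * exp (I * q * t)) l =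
      if l ∈ s then b l else 0 := by
  have h : fourierCoeffOn Real.two_pi_pos (fun t : ℝ => ∑ q ∈ s, b q * exp (I * q * t)) l =
      ∑ q ∈ s, b q * fourierCoeffOn Real.two_pi_pos (fun t : ℝ => exp (I * q * t)) l := by
    simp_rw [← fourierCoeffOn.const_mul, fourierCoeffOn_two_pi, Finset.mul_sum]
    rw [intervalIntegral.integral_finsetSum, Finset.smul_sum]
    exact fun q _ => Continuous.intervalIntegrable (by fun_prop) _ _
  simp [h, fourierCoeffOn_two_pi_exp]

open Complex in
/-- A continuous periodic function with summable Fourier coefficients is the sum of its Fourier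
series. -/
theorem hasSum_fourierCoef {f : ℝ → ℝ} (hf : Continuous f)
    (hper : Function.Periodic f (2 * Real.pi)) (hs : Summable (fourierCoef f)) (t : ℝ) :
    HasSum (fun l => fourierCoef f l * exp (I * l * t)) (f t) := by
  have : Fact (0 < 2 * Real.pi - 0) := ⟨by simpa using Real.pi_pos⟩
  have hper' : Function.Periodic (fun t => (f t : ℂ)) (2 * Real.pi - 0) := by
    rw [sub_zero]
    exact hper.comp (fun x : ℝ => (x : ℂ))
  let F : C(AddCircle (2 * Real.pi - 0), ℂ) :=
    ⟨hper'.lift, continuous_coinduced_dom.mpr (continuous_ofReal.comp hf)⟩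
  have hF : ∀ t : ℝ, F (t : AddCircle (2 * Real.pi - 0)) = f t := fun t =>
    Function.Periodic.lift_coe hper' t
  have hc : ∀ l, fourierCoeff F l = fourierCoef f l := by
    intro l
    rw [fourierCoef, fourierCoeffOn_eq_integral, fourierCoeff_eq_intervalIntegral _ _ 0]
    simp only [hF]
    rw [zero_add, sub_zero]
  have h := has_pointwise_sum_fourier_series_of_summable (f := F)
    (by rw [show fourierCoeff F = fourierCoef f from funext hc]; exact hs) t
  simpa only [hc, hF, fourier_two_pi_apply, smul_eq_mul] using h

theorem fourierCoef_zero {f : ℝ → ℝ} (hf : f ∈ shapeSet) : fourierCoef f 0 = 0 := by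
  rw [fourierCoef, fourierCoeffOn_two_pi]
  simp [intervalIntegral.integral_ofReal, hf.2.2]

theorem _root_.Function.Periodic.deriv {f : ℝ → ℝ} {c : ℝ} (h : Function.Periodic f c) :
    Function.Periodic (deriv f) c := by
  intro x
  rw [← deriv_comp_add_const, show (fun x => f (x + c)) = f from funext h]

theorem _root_.Function.Periodic.iteratedDeriv {f : ℝ → ℝ} {c : ℝ} (h : Function.Periodic f c)
    (k : ℕ) : Function.Periodic (iteratedDeriv k f) c := by
  induction k with
  | zero => simpa using h
  | succ k ih => rw [iteratedDeriv_succ]; exact ih.deriv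

theorem norm_fourierCoef_deriv {f : ℝ → ℝ} (hf : ContDiff ℝ 1 f)
    (hper : Function.Periodic f (2 * Real.pi)) {l : ℤ} (hl : l ≠ 0) :
    ‖fourierCoef (deriv f) l‖ = |(l : ℝ)| * ‖fourierCoef f l‖ := by
  have hcont : Continuous (deriv f) := hf.continuous_deriv le_rfl
  have h := fourierCoeffOn_of_hasDerivAt (f := fun t => (f t : ℂ))
    (f' := fun t => ((deriv f t : ℝ) : ℂ)) Real.two_pi_pos hl
    (fun x _ => ((hf.differentiable one_ne_zero) x).hasDerivAt.ofReal_comp)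
    (Continuous.intervalIntegrable (by fun_prop) _ _)
  -- Periodicity removes the boundary term of the integration by parts.
  have h0 : f (2 * Real.pi) = f 0 := by simpa using hper 0
  rw [h0] at h
  have hl' : (l : ℂ) ≠ 0 := by exact_mod_cast hl
  have hpi : (Real.pi : ℂ) ≠ 0 := by exact_mod_cast Real.pi_ne_zero
  have h1 : fourierCoef (deriv f) l = Complex.I * l * fourierCoef f l := by
    simp only [fourierCoef, h]
    push_cast
    field_simp
    ring_nf
  rw [h1]
  simp

theorem norm_fourierCoef_iteratedDeriv {f : ℝ → ℝ} {k : ℕ} (hf : ContDiff ℝ k f)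
    (hper : Function.Periodic f (2 * Real.pi)) {l : ℤ} (hl : l ≠ 0) :
    ‖fourierCoef (iteratedDeriv k f) l‖ = |(l : ℝ)| ^ k * ‖fourierCoef f l‖ := by
  induction k with
  | zero => simp
  | succ k ih =>
    obtain ⟨hk, h1⟩ := contDiff_nat_succ_iff_contDiff_one_iteratedDeriv.1 hf
    rw [iteratedDeriv_succ, norm_fourierCoef_deriv h1 (hper.iteratedDeriv k) hl, ih hk, pow_succ']
    ring

theorem hasSum_sq_fourierCoeffOn_two_pi {g : ℝ → ℂ} (hg : Continuous g) :
    HasSum (fun l => ‖fourierCoeffOn Real.two_pi_pos g l‖ ^ 2)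
      ((2 * Real.pi)⁻¹ * ∫ t in (0 : ℝ)..2 * Real.pi, ‖g t‖ ^ 2) := by
  have h : MemLp g 2 (volume.restrict (Set.Ioc 0 (2 * Real.pi))) := by
    refine (memLp_two_iff_integrable_sq_norm hg.aestronglyMeasurable).2 ?_
    exact ((Continuous.continuousOn (by fun_prop)).integrableOn_compact
      isCompact_Icc).mono_set Set.Ioc_subset_Icc_self
  simpa using hasSum_sq_fourierCoeffOn Real.two_pi_pos h

/-- This is Parseval for the `k`-th derivative; at `l = 0` the weight vanishes because `k ≥ 1`. -/
theorem summable_pow_mul_norm_fourierCoef_sq {f : ℝ → ℝ} {k : ℕ} (hk : 1 ≤ k)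
    (hf : ContDiff ℝ k f) (hper : Function.Periodic f (2 * Real.pi)) :
    Summable fun l : ℤ => |(l : ℝ)| ^ (2 * k) * ‖fourierCoef f l‖ ^ 2 := by
  have hc : Continuous (iteratedDeriv k f) := hf.continuous_iteratedDeriv k le_rfl
  refine Summable.of_nonneg_of_le (fun l => by positivity) (fun l => ?_)
    (hasSum_sq_fourierCoeffOn_two_pi (g := fun t => ((iteratedDeriv k f t : ℝ) : ℂ))
      (by fun_prop)).summable
  rcases eq_or_ne l 0 with rfl | hl
  · rw [Int.cast_zero, abs_zero, zero_pow (by omega), zero_mul]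
    positivity
  · have := norm_fourierCoef_iteratedDeriv hf hper hl
    rw [fourierCoef] at this
    rw [this]
    exact le_of_eq (by ring)

open Complex in
/-- Parseval's identity for the distance of a trigonometric polynomial to a function. -/
theorem lintegral_trigSum_sub_sq {f : ℝ → ℝ} (hf : Continuous f) (s : Finset ℤ) (b : ℤ → ℂ) :
    ∫⁻ t in Set.Icc 0 (2 * Real.pi), ‖∑ l ∈ s, b l * exp (I * l * t) - (f t : ℂ)‖ₑ ^ 2 =
      ENNReal.ofReal (2 * Real.pi * (∑ l ∈ s, ‖b l - fourierCoef f l‖ ^ 2 +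
        ∑' l, if l ∈ s then 0 else ‖fourierCoef f l‖ ^ 2)) := by
  set g : ℝ → ℂ := fun t => ∑ l ∈ s, b l * exp (I * l * t) - (f t : ℂ) with hg
  have hgc : Continuous g := by fun_prop
  have hcoef : ∀ l, fourierCoeffOn Real.two_pi_pos g l =
      (if l ∈ s then b l else 0) - fourierCoef f l := by
    intro l
    rw [hg, fourierCoeffOn_two_pi_sub (by fun_prop) (by fun_prop), fourierCoeffOn_two_pi_trigSum,
      fourierCoef]
  have hP := hasSum_sq_fourierCoeffOn_two_pi hgc
  simp only [hcoef] at hP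
  have hsplit : ∑ l ∈ s, ‖b l - fourierCoef f l‖ ^ 2 +
      (∑' l, if l ∈ s then 0 else ‖fourierCoef f l‖ ^ 2) =
      (2 * Real.pi)⁻¹ * ∫ t in (0 : ℝ)..2 * Real.pi, ‖g t‖ ^ 2 := by
    have h1 : HasSum (fun l => if l ∈ s then ‖b l - fourierCoef f l‖ ^ 2 else 0)
        (∑ l ∈ s, ‖b l - fourierCoef f l‖ ^ 2) := by
      rw [← Finset.sum_congr rfl fun l hl => if_pos hl]
      exact hasSum_sum_of_ne_finset_zero fun l hl => if_neg hl
    -- Writing the tail as the full Parseval series minus a finite sum yields its value and its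
    -- convergence together.
    have h2 : (fun l => if l ∈ s then 0 else ‖fourierCoef f l‖ ^ 2) = fun l =>
        ‖(if l ∈ s then b l else 0) - fourierCoef f l‖ ^ 2 -
          if l ∈ s then ‖b l - fourierCoef f l‖ ^ 2 else 0 := by
      funext l
      split_ifs <;> simp
    rw [h2, (hP.sub h1).tsum_eq]
    ring
  have hpi : (0 : ℝ) < 2 * Real.pi := Real.two_pi_pos
  rw [hsplit, mul_inv_cancel_left₀ hpi.ne', intervalIntegral.integral_of_le hpi.le,
    ← integral_Icc_eq_integral_Ioc, ofReal_integral_eq_lintegral_ofReal]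
  · refine lintegral_congr fun t => ?_
    rw [← ofReal_norm, ENNReal.ofReal_pow (norm_nonneg _)]
  · exact (Continuous.continuousOn (by fun_prop)).integrableOn_compact isCompact_Icc
  · exact Eventually.of_forall fun t => by positivity

/-! ### Discrete orthogonality and aliasing -/

theorem mem_freqs {m : ℕ} {l : ℤ} : l ∈ freqs m ↔ l ≠ 0 ∧ |l| ≤ m := by
  simp [freqs, abs_le]

theorem card_freqs (m : ℕ) : (freqs m).card = 2 * m := by
  rw [freqs, Finset.card_erase_of_mem (by simp), Int.card_Icc]
  omega

open Complex in
/-- Discrete orthogonality of the characters on the equidistant design. -/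
theorem sum_exp_designPoint {n : ℕ} (hn : 0 < n) (q : ℤ) :
    ∑ i : Fin n, exp (I * q * designPoint n i) = if (n : ℤ) ∣ q then (n : ℂ) else 0 := by
  have hn' : (n : ℂ) ≠ 0 := by exact_mod_cast hn.ne'
  have hpi : (Real.pi : ℂ) ≠ 0 := by exact_mod_cast Real.pi_ne_zero
  -- The sum is geometric with ratio an `n`-th root of unity.
  set ζ : ℂ := exp (2 * Real.pi * I * q / n) with hζ
  have hterm : ∀ i : Fin n, exp (I * q * designPoint n i) = ζ ^ (i : ℕ) := by
    intro i
    rw [hζ, ← exp_nat_mul, designPoint]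
    congr 1
    push_cast
    ring
  have hroot : ζ = 1 ↔ (n : ℤ) ∣ q := by
    rw [hζ, exp_eq_one_iff]
    constructor
    · rintro ⟨p, hp⟩
      refine ⟨p, ?_⟩
      have h : (q : ℂ) = n * p := by
        field_simp at hp
        exact hp
      exact_mod_cast h
    · rintro ⟨p, rfl⟩
      refine ⟨p, ?_⟩
      push_cast
      field_simp
  have hpow : ζ ^ n = 1 := by
    rw [hζ, ← exp_nat_mul, mul_div_cancel₀ _ hn', exp_eq_one_iff]
    exact ⟨q, by ring⟩
  simp only [hterm]
  rw [Fin.sum_univ_eq_sum_range (fun i => ζ ^ i)]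
  split_ifs with h
  · simp [hroot.2 h]
  · have h1 : ζ ≠ 1 := fun h' => h (hroot.1 h')
    rw [geom_sum_eq h1, hpow, sub_self, zero_div]

theorem norm_fourierCoef_le_abs_mul {f : ℝ → ℝ} (hf : f ∈ shapeSet) (l : ℤ) :
    ‖fourierCoef f l‖ ≤ |(l : ℝ)| * ‖fourierCoef f l‖ := by
  rcases eq_or_ne l 0 with rfl | hl
  · simp [fourierCoef_zero hf]
  · refine le_mul_of_one_le_left (norm_nonneg _) ?_
    exact_mod_cast Int.one_le_abs hl

theorem summable_fourierCoef {f : ℝ → ℝ} (hf : f ∈ shapeSet)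
    (hs : Summable fun l : ℤ => |(l : ℝ)| * ‖fourierCoef f l‖) : Summable (fourierCoef f) :=
  Summable.of_norm <|
    hs.of_nonneg_of_le (fun _ => norm_nonneg _) (norm_fourierCoef_le_abs_mul hf)

open Complex in
/-- The aliasing error of the discrete Fourier coefficients of a shifted shape. -/
theorem norm_sum_design_sub_fourierCoef_le {f : ℝ → ℝ} (hf : f ∈ shapeSet)
    (hs : Summable fun l : ℤ => |(l : ℝ)| * ‖fourierCoef f l‖) {n : ℕ} {l : ℤ}
    (hl : 2 * |l| < n) (θ : ℝ) :
    ‖(n : ℂ)⁻¹ * ∑ i : Fin n, (f (designPoint n i - θ) : ℂ) * exp (-(I * l * designPoint n i)) -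
        exp (-(I * l * θ)) * fourierCoef f l‖ ≤
      ∑' q : ℤ, 2 / (n : ℝ) * (|(q : ℝ)| * ‖fourierCoef f q‖) := by
  have hn : 0 < n := by
    have := abs_nonneg l
    omega
  have hn' : (n : ℂ) ≠ 0 := by exact_mod_cast hn.ne'
  -- Each sample is expanded in its Fourier series; orthogonality on the design then keeps only the
  -- `q` congruent to `l` modulo `n`.
  have h1 : HasSum (fun q : ℤ => (n : ℂ)⁻¹ * ∑ i : Fin n,
        fourierCoef f q * exp (I * q * (designPoint n i - θ : ℝ)) *
          exp (-(I * l * designPoint n i)))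
      ((n : ℂ)⁻¹ * ∑ i : Fin n, (f (designPoint n i - θ) : ℂ) *
        exp (-(I * l * designPoint n i))) :=
    (hasSum_sum fun i _ =>
      (hasSum_fourierCoef hf.1 hf.2.1 (summable_fourierCoef hf hs) _).mul_right _).mul_left _
  have h2 : ∀ q : ℤ, (n : ℂ)⁻¹ * ∑ i : Fin n,
        fourierCoef f q * exp (I * q * (designPoint n i - θ : ℝ)) *
          exp (-(I * l * designPoint n i)) =
      exp (-(I * q * θ)) * fourierCoef f q * if (n : ℤ) ∣ q - l then 1 else 0 := by
    intro q
    have : ∀ i : Fin n, fourierCoef f q * exp (I * q * (designPoint n i - θ : ℝ)) *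
          exp (-(I * l * designPoint n i)) =
        exp (-(I * q * θ)) * fourierCoef f q * exp (I * (q - l : ℤ) * designPoint n i) := by
      intro i
      have h3 : exp (I * q * (designPoint n i - θ : ℝ)) * exp (-(I * l * designPoint n i)) =
          exp (-(I * q * θ)) * exp (I * (q - l : ℤ) * designPoint n i) := by
        rw [← exp_add, ← exp_add]
        congr 1
        push_cast
        ring
      linear_combination fourierCoef f q * h3
    simp only [this, ← Finset.mul_sum, sum_exp_designPoint hn]
    split_ifs
    · field_simp
    · simp
  simp only [h2] at h1
  have h3 := h1.sub (hasSum_ite_eq l (exp (-(I * l * θ)) * fourierCoef f l))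
  rw [← h3.tsum_eq]
  refine tsum_of_norm_bounded (hs.mul_left _).hasSum fun q => ?_
  have hn0 : (0 : ℝ) < n := by exact_mod_cast hn
  rcases eq_or_ne q l with rfl | hq
  · simp only [sub_self, dvd_zero, if_true, mul_one, norm_zero]
    positivity
  · rw [if_neg hq, sub_zero]
    split_ifs with hd
    -- A proper alias satisfies `|q - l| ≥ n` while `|l| < n / 2`, so `1 ≤ 2|q| / n`: the weight
    -- `|q|` pays for the factor `1 / n`.
    · have hq' : (n : ℤ) ≤ 2 * |q| := by
        have h4 : (n : ℤ) ≤ |q - l| :=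
          Int.le_of_dvd (abs_pos.2 (sub_ne_zero.2 hq)) ((dvd_abs _ _).2 hd)
        have h5 := abs_sub q l
        omega
      have hq'' : (n : ℝ) ≤ 2 * |(q : ℝ)| := by exact_mod_cast hq'
      rw [mul_one, norm_mul, norm_exp_neg_I_int_mul, one_mul, ← mul_assoc]
      refine le_mul_of_one_le_left (norm_nonneg _) ?_
      rw [div_mul_eq_mul_div, one_le_div hn0]
      exact hq''
    · rw [mul_zero, norm_zero]
      positivity

/-! ### Truncation bias in mean square and in sup norm -/

theorem natCast_lt_abs_of_notMem_freqs {m : ℕ} {l : ℤ} (h : l ∉ freqs m) (hl : l ≠ 0) :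
    (m : ℝ) < |(l : ℝ)| := by
  have : (m : ℤ) < |l| := by
    by_contra h'
    exact h (mem_freqs.2 ⟨hl, not_lt.1 h'⟩)
  exact_mod_cast this

theorem tsum_sq_fourierCoef_notMem_freqs_le {f : ℝ → ℝ} (hf : f ∈ shapeSet) {k : ℕ}
    (hs : Summable fun l : ℤ => |(l : ℝ)| ^ (2 * k) * ‖fourierCoef f l‖ ^ 2) {m : ℕ}
    (hm : 0 < m) :
    (∑' l, if l ∈ freqs m then 0 else ‖fourierCoef f l‖ ^ 2) ≤
      (∑' l : ℤ, |(l : ℝ)| ^ (2 * k) * ‖fourierCoef f l‖ ^ 2) * (1 / (m : ℝ) ^ (2 * k)) := by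
  have hm' : (0 : ℝ) < m := by exact_mod_cast hm
  have hle : ∀ l, (if l ∈ freqs m then 0 else ‖fourierCoef f l‖ ^ 2) ≤
      |(l : ℝ)| ^ (2 * k) * ‖fourierCoef f l‖ ^ 2 * (1 / (m : ℝ) ^ (2 * k)) := by
    intro l
    split_ifs with h
    · positivity
    · rcases eq_or_ne l 0 with rfl | hl
      · simp [fourierCoef_zero hf]
      · rw [mul_one_div, le_div_iff₀ (by positivity), mul_comm]
        gcongr
        exact (natCast_lt_abs_of_notMem_freqs h hl).le
  rw [← tsum_mul_right]
  refine Summable.tsum_le_tsum hle (Summable.of_nonneg_of_le (fun l => ?_) hle (hs.mul_right _))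
    (hs.mul_right _)
  split_ifs <;> positivity

/-- Telescoping: the terms `±(N + 1)` together contribute `2 / (N + 1)²`, which is at most `2 / N -
2 / (N + 1)`. -/
theorem sum_inv_sq_notMem_freqs_le {m : ℕ} (hm : 0 < m) (s : Finset ℤ) :
    (∑ l ∈ s, if l ∈ freqs m ∨ l = 0 then (0 : ℝ) else 1 / (l : ℝ) ^ 2) ≤ 2 / (m : ℝ) := by
  set w : ℤ → ℝ := fun l => if l ∈ freqs m ∨ l = 0 then (0 : ℝ) else 1 / (l : ℝ) ^ 2 with hw
  have hw0 : ∀ l, 0 ≤ w l := by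
    intro l
    rw [hw]
    dsimp only
    split_ifs <;> positivity
  have hwle : ∀ l, w l ≤ 1 / (l : ℝ) ^ 2 := by
    intro l
    rw [hw]
    dsimp only
    split_ifs <;> first | positivity | exact le_rfl
  have hmain : ∀ N : ℕ, m ≤ N →
      ∑ l ∈ Finset.Icc (-(N : ℤ)) N, w l ≤ 2 / m - 2 / N := by
    intro N hN
    induction N, hN using Nat.le_induction with
    | base =>
      rw [sub_self]
      refine (Finset.sum_eq_zero fun l hl => if_pos ?_).le
      rw [Finset.mem_Icc] at hl
      rcases eq_or_ne l 0 with h | h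
      · exact Or.inr h
      · exact Or.inl (mem_freqs.2 ⟨h, abs_le.2 hl⟩)
    | succ N hN ih =>
      have hN0 : (0 : ℝ) < N := by exact_mod_cast hm.trans_le hN
      have hins : Finset.Icc (-((N + 1 : ℕ) : ℤ)) (N + 1 : ℕ) =
          insert ((N : ℤ) + 1) (insert (-((N : ℤ) + 1)) (Finset.Icc (-(N : ℤ)) N)) := by
        ext l
        simp only [Finset.mem_Icc, Finset.mem_insert]
        omega
      rw [hins, Finset.sum_insert (by simp; omega), Finset.sum_insert (by simp)]
      have h1 : w ((N : ℤ) + 1) ≤ 1 / ((N : ℝ) + 1) ^ 2 := by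
        refine (hwle _).trans_eq ?_
        push_cast
        rfl
      have h2 : w (-((N : ℤ) + 1)) ≤ 1 / ((N : ℝ) + 1) ^ 2 := by
        refine (hwle _).trans_eq ?_
        push_cast
        rw [neg_sq]
      have h3 : 2 * (1 / ((N : ℝ) + 1) ^ 2) ≤ 2 / N - 2 / ((N + 1 : ℕ) : ℝ) := by
        push_cast
        rw [div_sub_div _ _ hN0.ne' (by positivity), mul_one_div,
          div_le_div_iff₀ (by positivity) (by positivity)]
        nlinarith
      linarith
  obtain ⟨N, hN⟩ : ∃ N : ℕ, m ≤ N ∧ ∀ l ∈ s, |l| ≤ N := by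
    refine ⟨m + s.sup Int.natAbs, by omega, fun l hl => ?_⟩
    have := Finset.le_sup (f := Int.natAbs) hl
    rw [Int.abs_eq_natAbs]
    omega
  have hsub : s ⊆ Finset.Icc (-(N : ℤ)) N := fun l hl =>
    Finset.mem_Icc.2 (abs_le.1 (hN.2 l hl))
  calc ∑ l ∈ s, w l ≤ ∑ l ∈ Finset.Icc (-(N : ℤ)) N, w l :=
        Finset.sum_le_sum_of_subset_of_nonneg hsub fun l _ _ => hw0 l
    _ ≤ 2 / m - 2 / N := hmain N hN.1
    _ ≤ 2 / m := sub_le_self _ (by positivity)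

/-- Cauchy–Schwarz between `|l|^{-k}` and `|l|^k ‖c_l‖`. The tail of `|l|^{-2k}` is of order
`m^{1-2k}`, which costs the half power relative to the mean-square bias. -/
theorem tsum_norm_fourierCoef_notMem_freqs_le {f : ℝ → ℝ} (hf : f ∈ shapeSet) {k : ℕ}
    (hk : 1 ≤ k)
    (hs : Summable fun l : ℤ => |(l : ℝ)| ^ (2 * k) * ‖fourierCoef f l‖ ^ 2) {m : ℕ}
    (hm : 0 < m) :
    (∑' l, if l ∈ freqs m then 0 else ‖fourierCoef f l‖) ≤
      √(2 * ∑' l : ℤ, |(l : ℝ)| ^ (2 * k) * ‖fourierCoef f l‖ ^ 2) *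
        (1 / (m : ℝ) ^ ((k : ℝ) - 1 / 2)) := by
  set A := ∑' l : ℤ, |(l : ℝ)| ^ (2 * k) * ‖fourierCoef f l‖ ^ 2 with hA
  have hA0 : 0 ≤ A := tsum_nonneg fun l => by positivity
  have hm' : (0 : ℝ) < m := by exact_mod_cast hm
  have hpow : 1 / (m : ℝ) ^ ((k : ℝ) - 1 / 2) = √(m / (m : ℝ) ^ (2 * k)) := by
    symm
    rw [Real.sqrt_eq_iff_mul_self_eq (by positivity) (by positivity), div_mul_div_comm,
      ← Real.rpow_add hm', show (k : ℝ) - 1 / 2 + (k - 1 / 2) = ((2 * k : ℕ) : ℝ) - 1 by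
        push_cast; ring, Real.rpow_sub_one hm'.ne', Real.rpow_natCast]
    field_simp
  refine Real.tsum_le_of_sum_le (fun l => ?_) fun s => ?_
  · split_ifs <;> positivity
  set p : ℤ → ℝ := fun l => if l ∈ freqs m ∨ l = 0 then 0 else 1 / |(l : ℝ)| ^ k with hp
  have hpq : ∀ l, (if l ∈ freqs m then 0 else ‖fourierCoef f l‖) ≤
      p l * (|(l : ℝ)| ^ k * ‖fourierCoef f l‖) := by
    intro l
    rw [hp]
    dsimp only
    rcases eq_or_ne l 0 with rfl | hl
    · simp [fourierCoef_zero hf]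
    · have : (0 : ℝ) < |(l : ℝ)| := abs_pos.2 (by exact_mod_cast hl)
      by_cases h : l ∈ freqs m
      · simp [h]
      · simp only [h, hl, or_self, if_false]
        field_simp
        exact le_rfl
  have hp2 : ∑ l ∈ s, p l ^ 2 ≤ 2 * (m / (m : ℝ) ^ (2 * k)) := by
    -- Only `|l|^{-2}` is left to sum; the factor `|l|^{-(2k-2)}` is bounded by its value at `m`,
    -- which treats all `k ≥ 1` at once.
    have hterm : ∀ l, p l ^ 2 ≤ (m : ℝ) ^ 2 / (m : ℝ) ^ (2 * k) *
        if l ∈ freqs m ∨ l = 0 then 0 else 1 / (l : ℝ) ^ 2 := by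
      intro l
      rw [hp]
      dsimp only
      split_ifs with h
      · simp
      · push Not at h
        have h1 := (natCast_lt_abs_of_notMem_freqs h.1 h.2).le
        have h2 : (0 : ℝ) < |(l : ℝ)| := hm'.trans_le h1
        obtain ⟨k, rfl⟩ := Nat.exists_eq_add_of_le' hk
        rw [div_pow, one_pow, ← pow_mul, div_mul_div_comm, ← sq_abs (l : ℝ),
          div_le_div_iff₀ (by positivity) (by positivity)]
        calc 1 * ((m : ℝ) ^ (2 * (k + 1)) * |(l : ℝ)| ^ 2)
            = (m : ℝ) ^ 2 * |(l : ℝ)| ^ 2 * (m : ℝ) ^ (2 * k) := by ring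
          _ ≤ (m : ℝ) ^ 2 * |(l : ℝ)| ^ 2 * |(l : ℝ)| ^ (2 * k) := by gcongr
          _ = _ := by ring
    calc ∑ l ∈ s, p l ^ 2 ≤ (m : ℝ) ^ 2 / (m : ℝ) ^ (2 * k) * (2 / m) := by
          refine (Finset.sum_le_sum fun l _ => hterm l).trans ?_
          rw [← Finset.mul_sum]
          gcongr
          exact sum_inv_sq_notMem_freqs_le hm s
      _ = _ := by field_simp
  have hq2 : ∑ l ∈ s, (|(l : ℝ)| ^ k * ‖fourierCoef f l‖) ^ 2 ≤ A := by
    have : ∀ l : ℤ, (|(l : ℝ)| ^ k * ‖fourierCoef f l‖) ^ 2 =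
        |(l : ℝ)| ^ (2 * k) * ‖fourierCoef f l‖ ^ 2 := fun l => by ring
    simp only [this]
    exact hs.sum_le_tsum s fun l _ => by positivity
  calc _ ≤ ∑ l ∈ s, p l * (|(l : ℝ)| ^ k * ‖fourierCoef f l‖) :=
        Finset.sum_le_sum fun l _ => hpq l
    _ ≤ √(∑ l ∈ s, p l ^ 2) * √(∑ l ∈ s, (|(l : ℝ)| ^ k * ‖fourierCoef f l‖) ^ 2) :=
        Real.sum_mul_le_sqrt_mul_sqrt _ _ _
    _ ≤ √(2 * (m / (m : ℝ) ^ (2 * k))) * √A := by gcongr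
    _ = _ := by
        rw [hpow, ← Real.sqrt_mul (by positivity), ← Real.sqrt_mul (by positivity)]
        congr 1
        ring

open Complex in
/-- Uniform distance of a trigonometric polynomial to a shape. -/
theorem norm_trigSum_sub_le {f : ℝ → ℝ} (hf : f ∈ shapeSet) (hs : Summable (fourierCoef f))
    (s : Finset ℤ) (b : ℤ → ℂ) (t : ℝ) :
    ‖∑ l ∈ s, b l * exp (I * l * t) - (f t : ℂ)‖ ≤
      √s.card * √(∑ l ∈ s, ‖b l - fourierCoef f l‖ ^ 2) +
        ∑' l, if l ∈ s then 0 else ‖fourierCoef f l‖ := by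
  have h1 := hasSum_fourierCoef hf.1 hf.2.1 hs t
  have h2 : HasSum (fun l => if l ∈ s then fourierCoef f l * exp (I * l * t) else 0)
      (∑ l ∈ s, fourierCoef f l * exp (I * l * t)) := by
    rw [← Finset.sum_congr rfl fun l hl => if_pos hl]
    exact hasSum_sum_of_ne_finset_zero fun l hl => if_neg hl
  have h3 : ‖(f t : ℂ) - ∑ l ∈ s, fourierCoef f l * exp (I * l * t)‖ ≤
      ∑' l, if l ∈ s then 0 else ‖fourierCoef f l‖ := by
    rw [← (h1.sub h2).tsum_eq]
    refine tsum_of_norm_bounded (Summable.hasSum ?_) fun l => ?_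
    · refine Summable.of_nonneg_of_le (fun l => ?_) (fun l => ?_) hs.norm
      · split_ifs <;> positivity
      · split_ifs
        · positivity
        · exact le_rfl
    · split_ifs
      · simp
      · rw [sub_zero, norm_mul, norm_exp_I_int_mul, mul_one]
  have h4 : ‖∑ l ∈ s, b l * exp (I * l * t) - ∑ l ∈ s, fourierCoef f l * exp (I * l * t)‖ ≤
      √s.card * √(∑ l ∈ s, ‖b l - fourierCoef f l‖ ^ 2) := by
    rw [← Finset.sum_sub_distrib]
    calc _ ≤ ∑ l ∈ s, 1 * ‖b l - fourierCoef f l‖ := by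
          refine (norm_sum_le _ _).trans_eq (Finset.sum_congr rfl fun l _ => ?_)
          rw [← sub_mul, norm_mul, norm_exp_I_int_mul, mul_one, one_mul]
      _ ≤ _ := by
          refine (Real.sum_mul_le_sqrt_mul_sqrt _ _ _).trans_eq ?_
          simp
  calc _ = ‖(∑ l ∈ s, b l * exp (I * l * t) - ∑ l ∈ s, fourierCoef f l * exp (I * l * t)) -
        ((f t : ℂ) - ∑ l ∈ s, fourierCoef f l * exp (I * l * t))‖ := by congr 1; ring
    _ ≤ _ := (norm_sub_le _ _).trans (add_le_add h4 h3)

/-! ### Second moments of linear forms in Gaussian noise -/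

theorem integral_sq_sum_mul_gaussian {Ω ι : Type*} [MeasurableSpace Ω] {P : Measure Ω}
    [IsProbabilityMeasure P] [Fintype ι] {X : ι → Ω → ℝ}
    (hlaw : ∀ i, HasLaw (X i) (gaussianReal 0 1) P) (hind : iIndepFun X P) (c : ι → ℝ) :
    Integrable (fun ω => (∑ i, X i ω * c i) ^ 2) P ∧
      ∫ ω, (∑ i, X i ω * c i) ^ 2 ∂P = ∑ i, c i ^ 2 := by
  have hX : ∀ i, MemLp (X i) 2 P := fun i => by
    have h := memLp_id_gaussianReal (μ := 0) (v := 1) 2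
    rw [← (hlaw i).map_eq, memLp_map_measure_iff aestronglyMeasurable_id (hlaw i).aemeasurable] at h
    exact h
  have hXc : ∀ i, MemLp (fun ω => X i ω * c i) 2 P := fun i => (hX i).mul_const (c i)
  have hsum : MemLp (∑ i, fun ω => X i ω * c i) 2 P := memLp_finsetSum' _ fun i _ => hXc i
  have hfun : (∑ i, fun ω => X i ω * c i) = fun ω => ∑ i, X i ω * c i := by
    ext ω
    simp
  have hmean : ∫ ω, (∑ i, fun ω => X i ω * c i) ω ∂P = 0 := by
    rw [hfun, integral_finsetSum _ fun i _ => (hXc i).integrable one_le_two]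
    refine Finset.sum_eq_zero fun i _ => ?_
    rw [integral_mul_const, (hlaw i).integral_eq, integral_id_gaussianReal, zero_mul]
  have hvar := IndepFun.variance_sum (s := Finset.univ) (X := fun i ω => X i ω * c i)
    (fun i _ => hXc i) fun i _ j _ hij =>
      (hind.indepFun hij).comp (measurable_id.mul_const (c i)) (measurable_id.mul_const (c j))
  rw [variance_of_integral_eq_zero hsum.aemeasurable hmean] at hvar
  rw [hfun] at hsum hvar
  refine ⟨hsum.integrable_sq, hvar.trans (Finset.sum_congr rfl fun i _ => ?_)⟩
  rw [variance_mul_const, (hlaw i).variance_eq, variance_id_gaussianReal]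
  simp

theorem lintegral_enorm_sq_sum_mul_gaussian {Ω ι : Type*} [MeasurableSpace Ω] {P : Measure Ω}
    [IsProbabilityMeasure P] [Fintype ι] {X : ι → Ω → ℝ}
    (hlaw : ∀ i, HasLaw (X i) (gaussianReal 0 1) P) (hind : iIndepFun X P) (z : ι → ℂ) :
    ∫⁻ ω, ENNReal.ofReal (‖∑ i, (X i ω : ℂ) * z i‖ ^ 2) ∂P = ENNReal.ofReal (∑ i, ‖z i‖ ^ 2) := by
  have hsplit : ∀ ω, ‖∑ i, (X i ω : ℂ) * z i‖ ^ 2 =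
      (∑ i, X i ω * (z i).re) ^ 2 + (∑ i, X i ω * (z i).im) ^ 2 := by
    intro ω
    rw [← Complex.normSq_eq_norm_sq, Complex.normSq_apply, Complex.re_sum, Complex.im_sum]
    simp only [Complex.re_ofReal_mul, Complex.im_ofReal_mul, sq]
  obtain ⟨i1, e1⟩ := integral_sq_sum_mul_gaussian hlaw hind fun i => (z i).re
  obtain ⟨i2, e2⟩ := integral_sq_sum_mul_gaussian hlaw hind fun i => (z i).im
  simp only [hsplit]
  have i3 : Integrable
    (fun ω => (∑ i, X i ω * (z i).re) ^ 2 + (∑ i, X i ω * (z i).im) ^ 2) P := i1.add i2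
  rw [← ofReal_integral_eq_lintegral_ofReal i3 (Eventually.of_forall fun ω => by positivity),
    integral_add i1 i2, e1, e2, ← Finset.sum_add_distrib]
  congr 1
  refine Finset.sum_congr rfl fun i _ => ?_
  rw [← Complex.normSq_eq_norm_sq, Complex.normSq_apply]
  ring

/-! ### The criterion as a least-squares problem, and the size of the perturbation -/

noncomputable section

open ComplexConjugate

/-- The discrete Fourier coefficient `n⁻¹ ∑_i y_i e^{-il t_i}` of a curve sampled on the design. -/
def curveCoef (n : ℕ) (y : Fin n → ℝ) (l : ℤ) : ℂ :=
  (n : ℂ)⁻¹ * ∑ i, (y i : ℂ) * Complex.exp (-(Complex.I * l * designPoint n i))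

/-- The factor `a_j e^{-ilθ_j}` by which the `j`-th curve multiplies the `l`-th Fourier coefficient
of the shape. -/
def direction {J : ℕ} (β : Param J) (j : Fin J) (l : ℤ) : ℂ :=
  β.scale j * Complex.exp (-(Complex.I * l * β.shift j))

/-- The energy, over the frequencies of `freqs m`, of the deviation of the discrete Fourier
coefficients of the curves from those of the model. -/
def perturbation {J : ℕ} (n m : ℕ) (β : Param J) (f : ℝ → ℝ) (σ : ℝ) (e : Fin n → Fin J → ℝ) : ℝ :=
  ∑ l ∈ freqs m, ∑ j, ‖curveCoef n (fun i => observation n β f σ e i j) l -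
    direction β j l * fourierCoef f l‖ ^ 2

theorem conj_exp_neg_I_int_mul (l : ℤ) (t : ℝ) :
    conj (Complex.exp (-(Complex.I * l * t))) = Complex.exp (Complex.I * l * t) := by
  rw [← Complex.exp_conj]
  simp

theorem sum_norm_direction_sq {J : ℕ} [NeZero J] {υmax : ℝ} {β : Param J}
    (hβ : β ∈ paramSet J υmax) (l : ℤ) : ∑ j, ‖direction β j l‖ ^ 2 = J := by
  rw [← hβ.2.2.2.1]
  refine Finset.sum_congr rfl fun j _ => ?_
  rw [direction, norm_mul, norm_exp_neg_I_int_mul, mul_one, Complex.norm_real, Real.norm_eq_abs,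
    sq_abs]

theorem sum_exp_neg_designPoint {n m : ℕ} (hmn : 2 * m < n) {l : ℤ} (hl : l ∈ freqs m) :
    ∑ i : Fin n, Complex.exp (-(Complex.I * l * designPoint n i)) = 0 := by
  rw [mem_freqs] at hl
  have h := sum_exp_designPoint (n := n) (by omega) (-l)
  rw [if_neg] at h
  · rw [← h]
    refine Finset.sum_congr rfl fun i _ => ?_
    push_cast
    ring_nf
  · rw [dvd_neg]
    intro hd
    have := Int.le_of_dvd (abs_pos.2 hl.1) ((dvd_abs _ _).2 hd)
    omega

/-- The level multiplies a vanishing character sum and drops out; pulling out the phase `e^{ilθ_j}`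
leaves the least-squares formula required by `sum_norm_sq_sub_le_of_fit`. -/
theorem coefEst_eq_sum_direction {J n m : ℕ} [NeZero J] {υmax : ℝ} {β : Param J}
    (hβ : β ∈ paramSet J υmax) (hmn : 2 * m < n) (Y : Fin n → Fin J → ℝ) {l : ℤ}
    (hl : l ∈ freqs m) :
    coefEst n Y β l =
      ((J : ℝ) : ℂ)⁻¹ * ∑ j, conj (direction β j l) * curveCoef n (fun i => Y i j) l := by
  have hsum : ∑ j, (β.scale j : ℂ) ^ 2 = ((J : ℝ) : ℂ) := by
    rw [← hβ.2.2.2.1]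
    push_cast
    rfl
  rw [coefEst, hsum, mul_comm (n : ℂ), mul_inv, mul_assoc]
  congr 1
  rw [Finset.mul_sum]
  refine Finset.sum_congr rfl fun j _ => ?_
  have h : ∑ i, ((Y i j - β.level j : ℝ) : ℂ) *
        Complex.exp (-(Complex.I * l * ((designPoint n i - β.shift j : ℝ) : ℂ))) =
      Complex.exp (Complex.I * l * β.shift j) *
        ∑ i, (Y i j : ℂ) * Complex.exp (-(Complex.I * l * designPoint n i)) := by
    have h0 := sum_exp_neg_designPoint hmn hl
    have h1 : ∑ i, (Y i j : ℂ) * Complex.exp (-(Complex.I * l * designPoint n i)) =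
        ∑ i, ((Y i j - β.level j : ℝ) : ℂ) * Complex.exp (-(Complex.I * l * designPoint n i)) := by
      push_cast
      simp only [sub_mul, Finset.sum_sub_distrib, ← Finset.mul_sum, h0, mul_zero, sub_zero]
    rw [h1, Finset.mul_sum]
    refine Finset.sum_congr rfl fun i _ => ?_
    rw [mul_left_comm, ← Complex.exp_add]
    congr 2
    push_cast
    ring
  rw [h, curveCoef, direction, map_mul, conj_exp_neg_I_int_mul, Complex.conj_ofReal]
  ring

/-- The minimizer is compared with the hybrid of the true shifts and scales and its own levels. The
first term of the criterion is then the same on both sides, and the coefficients ignore the levels.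
-/
theorem sum_norm_coefEst_sq_le {J n m : ℕ} [NeZero J] {υmax : ℝ} {β b : Param J}
    {Y : Fin n → Fin J → ℝ} (hβ : β ∈ paramSet J υmax) (hmn : 2 * m < n)
    (hb : IsCriterionArgmin υmax n m Y b) :
    ∑ l ∈ freqs m, ‖coefEst n Y β l‖ ^ 2 ≤ ∑ l ∈ freqs m, ‖coefEst n Y b l‖ ^ 2 := by
  set β' : Param J := (β.shift, β.scale, b.level) with hβ'
  have hmem : β' ∈ paramSet J υmax := ⟨hβ.1, hb.1.2.1, hβ.2.2⟩
  have hmin : criterion n m Y b ≤ criterion n m Y β' := hb.2 hmem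
  have hcoef : ∀ l ∈ freqs m, coefEst n Y β' l = coefEst n Y β l := fun l hl => by
    rw [coefEst_eq_sum_direction hmem hmn Y hl, coefEst_eq_sum_direction hβ hmn Y hl]
    rfl
  have hlevel : β'.level = b.level := rfl
  have hsum : ∑ l ∈ freqs m, ‖coefEst n Y β' l‖ ^ 2 = ∑ l ∈ freqs m, ‖coefEst n Y β l‖ ^ 2 :=
    Finset.sum_congr rfl fun l hl => by rw [hcoef l hl]
  rw [criterion, criterion, hlevel, hsum] at hmin
  linarith

/-- The estimated Fourier coefficients are as close to the true ones as the perturbation. -/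
theorem sum_norm_coefEst_sub_sq_le {J n m : ℕ} [NeZero J] {υmax : ℝ} {β b : Param J}
    {f : ℝ → ℝ} {σ : ℝ} {e : Fin n → Fin J → ℝ} (hβ : β ∈ paramSet J υmax) (hmn : 2 * m < n)
    (hb : IsCriterionArgmin υmax n m (observation n β f σ e) b) :
    ∑ l ∈ freqs m, ‖coefEst n (observation n β f σ e) b l - fourierCoef f l‖ ^ 2 ≤
      ((4 + 2 * β.scale 0 / √(J : ℝ)) / β.scale 0) ^ 2 * perturbation n m β f σ e := by
  have hJ : (0 : ℝ) < J := by exact_mod_cast NeZero.pos J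
  have h0 : ∀ {γ : Param J}, γ ∈ paramSet J υmax → ∀ l, direction γ 0 l = γ.scale 0 := by
    intro γ hγ l
    rw [direction, hγ.2.2.1]
    simp
  have hle := sum_norm_coefEst_sq_le hβ hmn hb
  have := sum_norm_sq_sub_le_of_fit (L := freqs m) hJ hβ.2.2.2.2 hb.1.2.2.2.2.le
    (fun j l => direction β j l) (fun j l => direction b j l)
    (fun j l => curveCoef n (fun i => observation n β f σ e i j) l)
    (fun l => sum_norm_direction_sq hβ l) (fun l => sum_norm_direction_sq hb.1 l)
    (fun l => coefEst n (observation n β f σ e) b l) (fun l => fourierCoef f l)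
    (fun l => coefEst n (observation n β f σ e) β l)
    (fun l => coefEst_eq_sum_direction hβ hmn _ l.2)
    (fun l => coefEst_eq_sum_direction hb.1 hmn _ l.2)
    (by
      rw [Finset.sum_coe_sort (freqs m) fun l => ‖coefEst n (observation n β f σ e) β l‖ ^ 2,
        Finset.sum_coe_sort (freqs m) fun l => ‖coefEst n (observation n β f σ e) b l‖ ^ 2]
      exact hle)
    0 (fun l => h0 hβ l) (fun l => h0 hb.1 l)
  rw [Finset.sum_coe_sort (freqs m) fun l =>
      ‖coefEst n (observation n β f σ e) b l - fourierCoef f l‖ ^ 2,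
    Finset.sum_coe_sort (freqs m) fun l =>
      ∑ j, ‖curveCoef n (fun i => observation n β f σ e i j) l -
        direction β j l * fourierCoef f l‖ ^ 2] at this
  exact this

/-- Separates the deterministic aliasing error from the noise; the level again sums to zero. -/
theorem curveCoef_observation_sub {J n m : ℕ} {β : Param J} {f : ℝ → ℝ} {σ : ℝ}
    {e : Fin n → Fin J → ℝ} (hmn : 2 * m < n) {l : ℤ} (hl : l ∈ freqs m) (j : Fin J) :
    curveCoef n (fun i => observation n β f σ e i j) l - direction β j l * fourierCoef f l =
      β.scale j * (curveCoef n (fun i => f (designPoint n i - β.shift j)) l -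
        Complex.exp (-(Complex.I * l * β.shift j)) * fourierCoef f l) +
      σ * curveCoef n (fun i => e i j) l := by
  have h0 := sum_exp_neg_designPoint hmn hl
  simp only [curveCoef, observation, direction]
  push_cast
  simp only [add_mul, Finset.sum_add_distrib, mul_assoc, ← Finset.mul_sum] at h0 ⊢
  rw [h0]
  ring

theorem perturbation_le {J n m : ℕ} [NeZero J] {υmax : ℝ} {β : Param J}
    (hβ : β ∈ paramSet J υmax) {f : ℝ → ℝ} (hf : f ∈ shapeSet)
    (hs : Summable fun l : ℤ => |(l : ℝ)| * ‖fourierCoef f l‖) (σ : ℝ) (e : Fin n → Fin J → ℝ)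
    (hmn : 2 * m < n) :
    perturbation n m β f σ e ≤
      16 * J * (∑' l : ℤ, |(l : ℝ)| * ‖fourierCoef f l‖) ^ 2 * (m / (n : ℝ)) +
        2 * σ ^ 2 * ∑ l ∈ freqs m, ∑ j, ‖curveCoef n (fun i => e i j) l‖ ^ 2 := by
  set S := ∑' l : ℤ, |(l : ℝ)| * ‖fourierCoef f l‖ with hS
  have hn : (1 : ℝ) ≤ n := by exact_mod_cast (by omega : 1 ≤ n)
  have hterm : ∀ l ∈ freqs m, ∀ j, ‖curveCoef n (fun i => observation n β f σ e i j) l -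
        direction β j l * fourierCoef f l‖ ^ 2 ≤
      β.scale j ^ 2 * (8 * S ^ 2 / n) + 2 * σ ^ 2 * ‖curveCoef n (fun i => e i j) l‖ ^ 2 := by
    intro l hl j
    rw [curveCoef_observation_sub hmn hl j]
    set u := curveCoef n (fun i => f (designPoint n i - β.shift j)) l -
        Complex.exp (-(Complex.I * l * β.shift j)) * fourierCoef f l with hu
    have hu_le : ‖u‖ ≤ 2 / n * S := by
      rw [hS, ← tsum_mul_left]
      refine norm_sum_design_sub_fourierCoef_le hf hs ?_ _
      have := (mem_freqs.1 hl).2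
      omega
    -- The squared aliasing error is of order `n⁻²`; one factor `1 / n ≤ 1` is given away to match
    -- the order of the noise.
    have hu_sq : ‖u‖ ^ 2 ≤ 4 * S ^ 2 / n := by
      calc ‖u‖ ^ 2 ≤ (2 / n * S) ^ 2 := by gcongr
        _ = 4 * S ^ 2 / n * (1 / n) := by ring
        _ ≤ 4 * S ^ 2 / n * 1 := by
            gcongr
            rw [div_le_one (by linarith)]
            exact hn
        _ = _ := mul_one _
    have hadd : ‖(β.scale j : ℂ) * u + σ * curveCoef n (fun i => e i j) l‖ ≤
        |β.scale j| * ‖u‖ + |σ| * ‖curveCoef n (fun i => e i j) l‖ := by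
      refine (norm_add_le _ _).trans_eq ?_
      rw [norm_mul, norm_mul, Complex.norm_real, Complex.norm_real, Real.norm_eq_abs,
        Real.norm_eq_abs]
    calc _ ≤ (|β.scale j| * ‖u‖ + |σ| * ‖curveCoef n (fun i => e i j) l‖) ^ 2 := by gcongr
      _ ≤ 2 * ((|β.scale j| * ‖u‖) ^ 2 + (|σ| * ‖curveCoef n (fun i => e i j) l‖) ^ 2) :=
          add_sq_le
      _ = β.scale j ^ 2 * (2 * ‖u‖ ^ 2) +
          2 * σ ^ 2 * ‖curveCoef n (fun i => e i j) l‖ ^ 2 := by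
          rw [mul_pow, mul_pow, sq_abs, sq_abs]
          ring
      _ ≤ β.scale j ^ 2 * (2 * (4 * S ^ 2 / n)) +
          2 * σ ^ 2 * ‖curveCoef n (fun i => e i j) l‖ ^ 2 := by gcongr
      _ = _ := by ring
  calc perturbation n m β f σ e ≤ ∑ l ∈ freqs m, ∑ j, (β.scale j ^ 2 * (8 * S ^ 2 / n) +
        2 * σ ^ 2 * ‖curveCoef n (fun i => e i j) l‖ ^ 2) :=
        Finset.sum_le_sum fun l hl => Finset.sum_le_sum fun j _ => hterm l hl j
    _ = _ := by
        simp only [Finset.sum_add_distrib, ← Finset.sum_mul, ← Finset.mul_sum, hβ.2.2.2.1,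
          Finset.sum_const, card_freqs, nsmul_eq_mul]
        push_cast
        ring

theorem lintegral_norm_curveCoef_sq {Ω : Type*} [MeasurableSpace Ω] {P : Measure Ω}
    [IsProbabilityMeasure P] {n : ℕ} (hn : 0 < n) {X : Fin n → Ω → ℝ}
    (hlaw : ∀ i, HasLaw (X i) (gaussianReal 0 1) P) (hind : iIndepFun X P) (l : ℤ) :
    ∫⁻ ω, ENNReal.ofReal (‖curveCoef n (fun i => X i ω) l‖ ^ 2) ∂P =
      ENNReal.ofReal (1 / (n : ℝ)) := by
  have h : ∀ ω, curveCoef n (fun i => X i ω) l = ∑ i, (X i ω : ℂ) *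
      ((n : ℂ)⁻¹ * Complex.exp (-(Complex.I * l * designPoint n i))) := by
    intro ω
    rw [curveCoef, Finset.mul_sum]
    exact Finset.sum_congr rfl fun i _ => by ring
  simp only [h]
  rw [lintegral_enorm_sq_sum_mul_gaussian hlaw hind]
  congr 1
  have hn' : (n : ℝ) ≠ 0 := by exact_mod_cast hn.ne'
  simp only [norm_mul, norm_exp_neg_I_int_mul, norm_inv, RCLike.norm_natCast, mul_one,
    Finset.sum_const, Finset.card_univ, Fintype.card_fin, nsmul_eq_mul]
  field_simp

theorem continuous_curveCoef (n : ℕ) (l : ℤ) : Continuous fun y : Fin n → ℝ => curveCoef n y l := by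
  unfold curveCoef
  fun_prop

theorem continuous_perturbation {J : ℕ} (n m : ℕ) (β : Param J) (f : ℝ → ℝ) (σ : ℝ) :
    Continuous fun e : Fin n → Fin J → ℝ => perturbation n m β f σ e := by
  unfold perturbation curveCoef observation
  fun_prop

theorem measurable_coefEst_observation {J : ℕ} (n : ℕ) (β : Param J) (f : ℝ → ℝ) (σ : ℝ) (l : ℤ) :
    Measurable fun p : (Fin n → Fin J → ℝ) × Param J =>
      coefEst n (observation n β f σ p.1) p.2 l := by
  unfold coefEst observation Param.scale Param.level Param.shift
  fun_prop

/-! ### Measurability and mean of the perturbation -/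

section Noise

variable {Ω : Type*} [MeasurableSpace Ω] {P : Measure Ω} {J n : ℕ} {ε : Fin n → Fin J → Ω → ℝ}

theorem aemeasurable_noise (hlaw : ∀ i j, HasLaw (ε i j) (gaussianReal 0 1) P) :
    AEMeasurable (fun ω i j => ε i j ω) P :=
  aemeasurable_pi_iff.2 fun i => aemeasurable_pi_iff.2 fun j => (hlaw i j).aemeasurable

theorem aemeasurable_perturbation (hlaw : ∀ i j, HasLaw (ε i j) (gaussianReal 0 1) P) (m : ℕ)
    (β : Param J) (f : ℝ → ℝ) (σ : ℝ) :
    AEMeasurable (fun ω => perturbation n m β f σ fun i j => ε i j ω) P :=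
  (continuous_perturbation n m β f σ).measurable.comp_aemeasurable (aemeasurable_noise hlaw)

theorem aemeasurable_coefEst (hlaw : ∀ i j, HasLaw (ε i j) (gaussianReal 0 1) P)
    {b : Ω → Param J} (hb : AEMeasurable b P) (β : Param J) (f : ℝ → ℝ) (σ : ℝ) (l : ℤ) :
    AEMeasurable (fun ω => coefEst n (observation n β f σ fun i j => ε i j ω) (b ω) l) P := by
  have hpair : AEMeasurable (fun ω => ((fun i j => ε i j ω : Fin n → Fin J → ℝ), b ω)) P :=
    (aemeasurable_noise hlaw).prodMk hb
  have h := (measurable_coefEst_observation n β f σ l).comp_aemeasurable hpair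
  exact h

theorem lintegral_perturbation_le [IsProbabilityMeasure P] [NeZero J] {υmax : ℝ} {β : Param J}
    (hβ : β ∈ paramSet J υmax) {f : ℝ → ℝ} (hf : f ∈ shapeSet)
    (hs : Summable fun l : ℤ => |(l : ℝ)| * ‖fourierCoef f l‖) (σ : ℝ)
    (hlaw : ∀ i j, HasLaw (ε i j) (gaussianReal 0 1) P)
    (hind : iIndepFun (fun p : Fin n × Fin J => ε p.1 p.2) P) {m : ℕ} (hmn : 2 * m < n) :
    ∫⁻ ω, ENNReal.ofReal (perturbation n m β f σ fun i j => ε i j ω) ∂P ≤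
      ENNReal.ofReal ((16 * J * (∑' l : ℤ, |(l : ℝ)| * ‖fourierCoef f l‖) ^ 2 + 4 * J * σ ^ 2) *
        (m / (n : ℝ))) := by
  set S := ∑' l : ℤ, |(l : ℝ)| * ‖fourierCoef f l‖ with hS
  have hn : 0 < n := by omega
  -- There are `2m` frequencies and `J` curves, each coefficient having second moment `1 / n`.
  have hnoise : ∫⁻ ω, ENNReal.ofReal
      (∑ l ∈ freqs m, ∑ j, ‖curveCoef n (fun i => ε i j ω) l‖ ^ 2) ∂P =
      ENNReal.ofReal (2 * J * (m / (n : ℝ))) := by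
    have hcont : ∀ (l : ℤ) (j : Fin J), AEMeasurable
        (fun ω => ENNReal.ofReal (‖curveCoef n (fun i => ε i j ω) l‖ ^ 2)) P := fun l j =>
      (((continuous_curveCoef n l).norm.pow 2).measurable.comp_aemeasurable
        (aemeasurable_pi_iff.2 fun i => (hlaw i j).aemeasurable)).ennreal_ofReal
    have hpush : ∀ ω, ENNReal.ofReal (∑ l ∈ freqs m, ∑ j, ‖curveCoef n (fun i => ε i j ω) l‖ ^ 2) =
        ∑ l ∈ freqs m, ∑ j, ENNReal.ofReal (‖curveCoef n (fun i => ε i j ω) l‖ ^ 2) := by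
      intro ω
      rw [ENNReal.ofReal_sum_of_nonneg fun l _ => by positivity]
      exact Finset.sum_congr rfl fun l _ => ENNReal.ofReal_sum_of_nonneg fun j _ => by positivity
    simp only [hpush]
    rw [lintegral_finsetSum' _ fun l _ => Finset.aemeasurable_fun_sum _ fun j _ => hcont l j]
    have hinner : ∀ l : ℤ, ∫⁻ ω, ∑ j, ENNReal.ofReal (‖curveCoef n (fun i => ε i j ω) l‖ ^ 2) ∂P =
        ∑ _j : Fin J, ENNReal.ofReal (1 / (n : ℝ)) := by
      intro l
      rw [lintegral_finsetSum' _ fun j _ => hcont l j]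
      refine Finset.sum_congr rfl fun j _ => lintegral_norm_curveCoef_sq hn (fun i => hlaw i j) ?_ l
      exact hind.precomp (g := fun i : Fin n => (i, j)) fun a b h => (Prod.mk.inj h).1
    simp only [hinner, Finset.sum_const, Finset.card_univ, Fintype.card_fin, card_freqs,
      nsmul_eq_mul, ← ENNReal.ofReal_natCast]
    rw [← ENNReal.ofReal_mul (by positivity), ← ENNReal.ofReal_mul (by positivity)]
    congr 1
    push_cast
    ring
  calc _ ≤ ∫⁻ ω, (ENNReal.ofReal (16 * J * S ^ 2 * (m / (n : ℝ))) +
        ENNReal.ofReal (2 * σ ^ 2) * ENNReal.ofReal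
          (∑ l ∈ freqs m, ∑ j, ‖curveCoef n (fun i => ε i j ω) l‖ ^ 2)) ∂P := by
        refine lintegral_mono fun ω => ?_
        rw [← ENNReal.ofReal_mul (by positivity), ← ENNReal.ofReal_add (by positivity)
          (by positivity)]
        exact ENNReal.ofReal_le_ofReal (perturbation_le hβ hf hs σ _ hmn)
    _ = _ := by
        rw [lintegral_add_left measurable_const, lintegral_const, measure_univ, mul_one,
          lintegral_const_mul' _ _ ENNReal.ofReal_ne_top, hnoise,
          ← ENNReal.ofReal_mul (by positivity), ← ENNReal.ofReal_add (by positivity)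
          (by positivity)]
        congr 1
        ring

end Noise

end

/-! ### Integrated risk and uniform error -/

section Risk

variable {Ω : Type*} [MeasurableSpace Ω] {P : Measure Ω} [IsProbabilityMeasure P] {J n m : ℕ}
  {ε : Fin n → Fin J → Ω → ℝ} {b : Ω → Param J}

open Complex in
/-- Tonelli and Parseval for a random trigonometric polynomial. -/
theorem lintegral_lintegral_trigSum_sub_sq {c : ℤ → Ω → ℂ} (hc : ∀ l, AEMeasurable (c l) P)
    {f : ℝ → ℝ} (hf : Continuous f) (s : Finset ℤ) :
    ∫⁻ t in Set.Icc 0 (2 * Real.pi),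
        ∫⁻ ω, ‖∑ l ∈ s, c l ω * exp (I * l * t) - (f t : ℂ)‖ₑ ^ 2 ∂P =
      ∫⁻ ω, ENNReal.ofReal (2 * Real.pi * (∑ l ∈ s, ‖c l ω - fourierCoef f l‖ ^ 2 +
        ∑' l, if l ∈ s then 0 else ‖fourierCoef f l‖ ^ 2)) ∂P := by
  have hsum : AEMeasurable (fun p : ℝ × Ω => ∑ l ∈ s, c l p.2 * exp (I * l * p.1))
      ((volume.restrict (Set.Icc 0 (2 * Real.pi))).prod P) := by
    refine Finset.aemeasurable_fun_sum _ fun l _ => ?_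
    have hexp : Continuous fun t : ℝ => exp (I * l * t) := by fun_prop
    exact (hc l).comp_snd.mul (hexp.measurable.comp measurable_fst).aemeasurable
  have hf' : AEMeasurable (fun p : ℝ × Ω => (f p.1 : ℂ))
      ((volume.restrict (Set.Icc 0 (2 * Real.pi))).prod P) :=
    ((continuous_ofReal.comp hf).measurable.comp measurable_fst).aemeasurable
  rw [lintegral_lintegral_swap ((hsum.sub hf').enorm.pow_const 2)]
  exact lintegral_congr fun ω => lintegral_trigSum_sub_sq hf s fun l => c l ω

theorem mise_shapeEstimator (hlaw : ∀ i j, HasLaw (ε i j) (gaussianReal 0 1) P)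
    (hb : AEMeasurable b P) (m : ℕ) (β : Param J) {f : ℝ → ℝ} (hf : Continuous f) (σ : ℝ) :
    mise P (shapeEstimator n m β f σ ε b) f =
      ∫⁻ ω, ENNReal.ofReal (2 * Real.pi * (∑ l ∈ freqs m,
        ‖coefEst n (observation n β f σ fun i j => ε i j ω) (b ω) l - fourierCoef f l‖ ^ 2 +
          ∑' l, if l ∈ freqs m then 0 else ‖fourierCoef f l‖ ^ 2)) ∂P :=
  lintegral_lintegral_trigSum_sub_sq (aemeasurable_coefEst hlaw hb β f σ) hf (freqs m)

variable [NeZero J] {υmax : ℝ} {β : Param J} {f : ℝ → ℝ} {k : ℕ}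

theorem mise_shapeEstimator_le (hβ : β ∈ paramSet J υmax) (hf : f ∈ shapeSet) (σ : ℝ)
    (hs : Summable fun l : ℤ => |(l : ℝ)| * ‖fourierCoef f l‖)
    (hs2 : Summable fun l : ℤ => |(l : ℝ)| ^ (2 * k) * ‖fourierCoef f l‖ ^ 2)
    (hlaw : ∀ i j, HasLaw (ε i j) (gaussianReal 0 1) P)
    (hind : iIndepFun (fun p : Fin n × Fin J => ε p.1 p.2) P) (hm : 0 < m) (hmn : 2 * m < n)
    (hbm : AEMeasurable b P)
    (hb : ∀ᵐ ω ∂P, IsCriterionArgmin υmax n m (observation n β f σ fun i j => ε i j ω) (b ω)) :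
    mise P (shapeEstimator n m β f σ ε b) f ≤
      ENNReal.ofReal (2 * Real.pi * (((4 + 2 * β.scale 0 / √(J : ℝ)) / β.scale 0) ^ 2 *
        (16 * J * (∑' l : ℤ, |(l : ℝ)| * ‖fourierCoef f l‖) ^ 2 + 4 * J * σ ^ 2) +
          ∑' l : ℤ, |(l : ℝ)| ^ (2 * k) * ‖fourierCoef f l‖ ^ 2) *
        (1 / (m : ℝ) ^ (2 * k) + m / (n : ℝ))) := by
  set K := ((4 + 2 * β.scale 0 / √(J : ℝ)) / β.scale 0) ^ 2
  set K₁ := 16 * J * (∑' l : ℤ, |(l : ℝ)| * ‖fourierCoef f l‖) ^ 2 + 4 * J * σ ^ 2 with hK₁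
  set A := ∑' l : ℤ, |(l : ℝ)| ^ (2 * k) * ‖fourierCoef f l‖ ^ 2
  have hK0 : 0 ≤ K := by positivity
  have hK₁0 : 0 ≤ K₁ := by positivity
  have hA0 : 0 ≤ A := tsum_nonneg fun l => by positivity
  have hpi := Real.pi_pos.le
  rw [mise_shapeEstimator hlaw hbm m β hf.1 σ]
  calc _ ≤ ∫⁻ ω, (ENNReal.ofReal (2 * Real.pi * K) *
          ENNReal.ofReal (perturbation n m β f σ fun i j => ε i j ω) +
        ENNReal.ofReal (2 * Real.pi * (A * (1 / (m : ℝ) ^ (2 * k))))) ∂P := by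
        refine lintegral_mono_ae (hb.mono fun ω hω => ?_)
        have hpert : 0 ≤ perturbation n m β f σ fun i j => ε i j ω := by
          unfold perturbation
          positivity
        rw [← ENNReal.ofReal_mul (by positivity), ← ENNReal.ofReal_add (by positivity)
          (by positivity), mul_assoc (2 * Real.pi) K, ← mul_add]
        refine ENNReal.ofReal_le_ofReal ?_
        gcongr
        · exact sum_norm_coefEst_sub_sq_le hβ hmn hω
        · exact tsum_sq_fourierCoef_notMem_freqs_le hf hs2 hm
    _ = ENNReal.ofReal (2 * Real.pi * K) *
          ∫⁻ ω, ENNReal.ofReal (perturbation n m β f σ fun i j => ε i j ω) ∂P +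
        ENNReal.ofReal (2 * Real.pi * (A * (1 / (m : ℝ) ^ (2 * k)))) := by
        rw [lintegral_add_right _ measurable_const, lintegral_const, measure_univ, mul_one,
          lintegral_const_mul' _ _ ENNReal.ofReal_ne_top]
    _ ≤ ENNReal.ofReal (2 * Real.pi * K) * ENNReal.ofReal (K₁ * (m / (n : ℝ))) +
        ENNReal.ofReal (2 * Real.pi * (A * (1 / (m : ℝ) ^ (2 * k)))) := by
        gcongr
        exact lintegral_perturbation_le hβ hf hs σ hlaw hind hmn
    _ ≤ _ := by
        rw [← ENNReal.ofReal_mul (by positivity), ← ENNReal.ofReal_add (by positivity)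
          (by positivity)]
        refine ENNReal.ofReal_le_ofReal ?_
        -- The cross terms that allow one constant in front of the sum of both rates.
        have h1 : 0 ≤ 2 * Real.pi * (K * K₁ * (1 / (m : ℝ) ^ (2 * k)) + A * (m / (n : ℝ))) := by
          positivity
        linarith

theorem supError_shapeEst_le {e : Fin n → Fin J → ℝ} {σ : ℝ} {γ : Param J}
    (hβ : β ∈ paramSet J υmax) (hf : f ∈ shapeSet)
    (hs : Summable fun l : ℤ => |(l : ℝ)| * ‖fourierCoef f l‖) (hk : 1 ≤ k)
    (hs2 : Summable fun l : ℤ => |(l : ℝ)| ^ (2 * k) * ‖fourierCoef f l‖ ^ 2) (hm : 0 < m)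
    (hmn : 2 * m < n) (hγ : IsCriterionArgmin υmax n m (observation n β f σ e) γ) :
    supError (shapeEst n m (observation n β f σ e) γ) f ≤ ENNReal.ofReal
      (√(2 * m) * √(((4 + 2 * β.scale 0 / √(J : ℝ)) / β.scale 0) ^ 2 *
          perturbation n m β f σ e) +
        √(2 * ∑' l : ℤ, |(l : ℝ)| ^ (2 * k) * ‖fourierCoef f l‖ ^ 2) *
          (1 / (m : ℝ) ^ ((k : ℝ) - 1 / 2))) := by
  refine iSup_le fun t => ?_
  rw [← ofReal_norm]
  refine ENNReal.ofReal_le_ofReal ?_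
  refine (norm_trigSum_sub_le hf (summable_fourierCoef hf hs) (freqs m) _ t).trans ?_
  rw [card_freqs]
  push_cast
  gcongr
  · exact sum_norm_coefEst_sub_sq_le hβ hmn hγ
  · exact tsum_norm_fourierCoef_notMem_freqs_le hf hk hs2 hm

/-- The uniform error exceeds a multiple of the rate with small probability. -/
theorem measure_lt_supError_le (hβ : β ∈ paramSet J υmax) (hf : f ∈ shapeSet) (σ : ℝ)
    (hs : Summable fun l : ℤ => |(l : ℝ)| * ‖fourierCoef f l‖) (hk : 1 ≤ k)
    (hs2 : Summable fun l : ℤ => |(l : ℝ)| ^ (2 * k) * ‖fourierCoef f l‖ ^ 2)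
    (hlaw : ∀ i j, HasLaw (ε i j) (gaussianReal 0 1) P)
    (hind : iIndepFun (fun p : Fin n × Fin J => ε p.1 p.2) P) (hm : 0 < m) (hmn : 2 * m < n)
    (hb : ∀ᵐ ω ∂P, IsCriterionArgmin υmax n m (observation n β f σ fun i j => ε i j ω) (b ω))
    {τ : ℝ} (hτ : 0 < τ) :
    P {ω | ENNReal.ofReal
        ((√(2 * ((4 + 2 * β.scale 0 / √(J : ℝ)) / β.scale 0) ^ 2 * τ) +
          √(2 * ∑' l : ℤ, |(l : ℝ)| ^ (2 * k) * ‖fourierCoef f l‖ ^ 2)) *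
          (1 / (m : ℝ) ^ ((k : ℝ) - 1 / 2) + m / √(n : ℝ))) <
        supError (shapeEstimator n m β f σ ε b ω) f} ≤
      ENNReal.ofReal
        ((16 * J * (∑' l : ℤ, |(l : ℝ)| * ‖fourierCoef f l‖) ^ 2 + 4 * J * σ ^ 2) / τ) := by
  set K := ((4 + 2 * β.scale 0 / √(J : ℝ)) / β.scale 0) ^ 2
  set K₁ := 16 * J * (∑' l : ℤ, |(l : ℝ)| * ‖fourierCoef f l‖) ^ 2 + 4 * J * σ ^ 2 with hK₁
  set B := √(2 * ∑' l : ℤ, |(l : ℝ)| ^ (2 * k) * ‖fourierCoef f l‖ ^ 2)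
  have hK0 : 0 ≤ K := by positivity
  have hK₁0 : 0 ≤ K₁ := by positivity
  have hB0 : 0 ≤ B := Real.sqrt_nonneg _
  have hm0 : (0 : ℝ) < m := by exact_mod_cast hm
  have hn0 : (0 : ℝ) < n := by exact_mod_cast (by omega : 0 < n)
  set V : Ω → ℝ := fun ω => perturbation n m β f σ fun i j => ε i j ω with hV
  set c : ℝ := m / n with hc
  have hc0 : 0 < c := by positivity
  -- Whenever the perturbation stays below `τ * m / n`, the pathwise sup bound stays below the
  -- threshold; Markov's inequality then handles the complement.
  have hsub : P {ω | ENNReal.ofReal ((√(2 * K * τ) + B) *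
        (1 / (m : ℝ) ^ ((k : ℝ) - 1 / 2) + m / √(n : ℝ))) <
        supError (shapeEstimator n m β f σ ε b ω) f} ≤
      P {ω | ENNReal.ofReal (τ * c) ≤ ENNReal.ofReal (V ω)} := by
    refine measure_mono_ae (hb.mono fun ω hω hlt => ?_)
    refine ENNReal.ofReal_le_ofReal (le_of_not_gt fun hVlt => ?_)
    refine absurd hlt (not_lt.2 ((supError_shapeEst_le hβ hf hs hk hs2 hm hmn hω).trans ?_))
    refine ENNReal.ofReal_le_ofReal ?_
    have h1 : √(2 * m) * √(K * V ω) ≤ √(2 * K * τ) * (m / √(n : ℝ)) := by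
      have hmsq : (m : ℝ) / √(n : ℝ) = √((m : ℝ) ^ 2 / n) := by
        rw [Real.sqrt_div (by positivity), Real.sqrt_sq hm0.le]
      rw [hmsq, ← Real.sqrt_mul (by positivity), ← Real.sqrt_mul (by positivity)]
      refine Real.sqrt_le_sqrt ?_
      calc 2 * m * (K * V ω) ≤ 2 * m * (K * (τ * c)) := by gcongr
        _ = _ := by rw [hc]; ring
    have h2 : 0 ≤ √(2 * K * τ) * (1 / (m : ℝ) ^ ((k : ℝ) - 1 / 2)) := by positivity
    have h3 : 0 ≤ B * (m / √(n : ℝ)) := by positivity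
    calc _ ≤ √(2 * K * τ) * (m / √(n : ℝ)) + B * (1 / (m : ℝ) ^ ((k : ℝ) - 1 / 2)) := by
          gcongr
      _ ≤ _ := by linarith
  have hτc : ENNReal.ofReal (τ * c) ≠ 0 := by
    rw [Ne, ENNReal.ofReal_eq_zero, not_le]
    positivity
  calc _ ≤ (∫⁻ ω, ENNReal.ofReal (V ω) ∂P) / ENNReal.ofReal (τ * c) :=
        hsub.trans (meas_ge_le_lintegral_div
          (aemeasurable_perturbation hlaw m β f σ).ennreal_ofReal hτc ENNReal.ofReal_ne_top)
    _ ≤ ENNReal.ofReal (K₁ * c) / ENNReal.ofReal (τ * c) := by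
        gcongr
        exact lintegral_perturbation_le hβ hf hs σ hlaw hind hmn
    _ = _ := by
        rw [← ENNReal.ofReal_div_of_pos (by positivity), mul_div_mul_right _ _ hc0.ne']

end Risk

/-! ### Choice of the number of frequencies and conclusion -/

/-- The balance of squared bias and variance when the number of frequencies is of exact order
`n^{1/(2k+1)}`. -/
theorem exists_rate_le_of_isTheta {m : ℕ → ℕ} {k : ℕ}
    (hm : (fun n => (m n : ℝ)) =Θ[oddAtTop] fun n => (n : ℝ) ^ (1 / (2 * (k : ℝ) + 1))) :
    ∃ D : ℝ, ∀ᶠ n in oddAtTop, 1 / (m n : ℝ) ^ (2 * k) + (m n : ℝ) / (n : ℝ) ≤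
      D * (n : ℝ) ^ (-(2 * (k : ℝ)) / (2 * (k : ℝ) + 1)) := by
  obtain ⟨c₂, -, h₂⟩ := hm.1.exists_pos
  obtain ⟨c₁, hc₁, h₁⟩ := hm.2.exists_pos
  -- The lower bound `x ≤ c₁ m` controls the bias and the upper bound `m ≤ c₂ x` the variance, where
  -- `x = n^{1/(2k+1)}`.
  refine ⟨c₁ ^ (2 * k) + c₂, ?_⟩
  have hodd : ∀ᶠ n in oddAtTop, Odd n := mem_inf_of_right (mem_principal_self _)
  filter_upwards [h₁.bound, h₂.bound, hodd] with n hn₁ hn₂ hn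
  have hn0 : (0 : ℝ) < n := by exact_mod_cast hn.pos
  set x : ℝ := (n : ℝ) ^ (1 / (2 * (k : ℝ) + 1)) with hx
  have hx0 : 0 < x := Real.rpow_pos_of_pos hn0 _
  rw [Real.norm_of_nonneg hx0.le, Real.norm_of_nonneg (Nat.cast_nonneg _)] at hn₁ hn₂
  have hm0 : (0 : ℝ) < m n := pos_of_mul_pos_right (hx0.trans_le hn₁) hc₁.le
  have hkey : (n : ℝ) ^ (-(2 * (k : ℝ)) / (2 * (k : ℝ) + 1)) = 1 / x ^ (2 * k) := by
    rw [hx, ← Real.rpow_natCast, ← Real.rpow_mul hn0.le, one_div, ← Real.rpow_neg hn0.le]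
    congr 1
    push_cast
    ring
  -- Since `x^{2k+1} = n`, bias and variance have the same order.
  have hkey' : x / n = 1 / x ^ (2 * k) := by
    have hxn : x ^ (2 * k + 1) = n := by
      rw [hx, ← Real.rpow_natCast, ← Real.rpow_mul hn0.le]
      push_cast
      rw [one_div_mul_cancel (by positivity), Real.rpow_one]
    rw [← hxn, pow_succ]
    field_simp
  rw [hkey, add_mul]
  refine add_le_add ?_ ?_
  · rw [mul_one_div, div_le_div_iff₀ (by positivity) (by positivity), one_mul, ← mul_pow]
    gcongr
  · rw [← hkey', ← mul_div_assoc]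
    gcongr

end ShapeInvariant

theorem corollary3p1
    {Ω : Type*} [MeasurableSpace Ω] (P : Measure Ω) [IsProbabilityMeasure P]
    (J : ℕ) [NeZero J] (υmax : ℝ) (hυmax : 0 < υmax)
    -- the true parameters
    (β : Param J) (hβ : β ∈ paramSet J υmax) (σ : ℝ) (hσ : 0 < σ)
    (f : ℝ → ℝ) (hf : f ∈ shapeSet)
    -- for each `n`, the noise variables are independent standard Gaussian
    (ε : (n : ℕ) → Fin n → Fin J → Ω → ℝ)
    (hεlaw : ∀ n i j, HasLaw (ε n i j) (gaussianReal 0 1) P)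
    (hεind : ∀ n, iIndepFun (fun p : Fin n × Fin J => ε n p.1 p.2) P)
    -- smoothness of the shape
    (k : ℕ) (hk : 1 ≤ k) (hfk : ContDiff ℝ k f)
    (hfk2 : IntervalIntegrable (fun t => iteratedDeriv k f t ^ 2) volume 0 (2 * Real.pi))
    -- the assumptions of the efficiency theorem on the parameters
    (hfconst : ¬ ∃ c : ℝ, ∀ t, f t = c)
    (hscale : ∀ j, β.scale j ≠ 0)
    (hfsum : Summable (fun l : ℤ => |(l : ℝ)| * ‖fourierCoef f l‖)) :
    ∃ C : ℝ, ∀ (m : ℕ → ℕ) (βhat : ℕ → Ω → Param J),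
      (∀ n, Odd n → 2 * m n < n) →
      Tendsto m oddAtTop atTop →
      (∀ n, AEMeasurable (βhat n) P) →
      (∀ n, Odd n → ∀ᵐ ω ∂P, IsCriterionArgmin υmax n (m n)
        (observation n β f σ (fun i j => ε n i j ω)) (βhat n ω)) →
      (Tendsto (fun n => (m n : ℝ) ^ 4 / (n : ℝ)) oddAtTop (𝓝 0) →
        IsBigOInProb oddAtTop P
          (fun n ω => supError (shapeEstimator n (m n) β f σ (ε n) (βhat n) ω) f)
          (fun n => 1 / (m n : ℝ) ^ ((k : ℝ) - 1 / 2) + (m n : ℝ) / √(n : ℝ)) ∧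
        ∀ᶠ n in oddAtTop,
          mise P (shapeEstimator n (m n) β f σ (ε n) (βhat n)) f ≤
            ENNReal.ofReal (C * (1 / (m n : ℝ) ^ (2 * k) + (m n : ℝ) / (n : ℝ)))) ∧
      ((fun n => (m n : ℝ)) =Θ[oddAtTop] (fun n => (n : ℝ) ^ (1 / (2 * (k : ℝ) + 1))) →
        ∃ C' : ℝ, ∀ᶠ n in oddAtTop,
          mise P (shapeEstimator n (m n) β f σ (ε n) (βhat n)) f ≤
            ENNReal.ofReal (C' * (n : ℝ) ^ (-(2 * (k : ℝ)) / (2 * (k : ℝ) + 1)))) := by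
  have hs2 := summable_pow_mul_norm_fourierCoef_sq hk hfk hf.2.1
  set K := ((4 + 2 * β.scale 0 / √(J : ℝ)) / β.scale 0) ^ 2 with hK
  set K₁ := 16 * J * (∑' l : ℤ, |(l : ℝ)| * ‖fourierCoef f l‖) ^ 2 + 4 * J * σ ^ 2 with hK₁
  set A := ∑' l : ℤ, |(l : ℝ)| ^ (2 * k) * ‖fourierCoef f l‖ ^ 2 with hA
  have hA0 : 0 ≤ A := tsum_nonneg fun l => by positivity
  have hC0 : 0 ≤ 2 * Real.pi * (K * K₁ + A) := by
    have := Real.pi_pos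
    positivity
  -- `K` is the stability constant, `K₁` bounds the mean perturbation in units of `m / n`, and `A`
  -- the squared bias in units of `m^{-2k}`; all are fixed before `m`.
  refine ⟨2 * Real.pi * (K * K₁ + A), fun m βhat hmn hm hβm hβhat => ?_⟩
  have hodd : ∀ᶠ n in oddAtTop, Odd n := mem_inf_of_right (mem_principal_self _)
  have hmise : ∀ᶠ n in oddAtTop, mise P (shapeEstimator n (m n) β f σ (ε n) (βhat n)) f ≤
      ENNReal.ofReal (2 * Real.pi * (K * K₁ + A) *
        (1 / (m n : ℝ) ^ (2 * k) + (m n : ℝ) / (n : ℝ))) := by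
    filter_upwards [hodd, hm.eventually_gt_atTop 0] with n hn hmn0
    exact mise_shapeEstimator_le hβ hf σ hfsum hs2 (hεlaw n) (hεind n) hmn0 (hmn n hn) (hβm n)
      (hβhat n hn)
  refine ⟨fun _ => ⟨fun δ hδ => ?_, hmise⟩, fun hΘ => ?_⟩
  -- Markov gives probability at most `K₁ / τ`, which this choice makes at most `δ`; the `+ 1`
  -- ensures `τ > 0`.
  · set τ := K₁ / δ + 1 with hτ
    have hτ0 : 0 < τ := by positivity
    refine ⟨√(2 * K * τ) + √(2 * A), ?_, ?_⟩
    · have hK0 : 0 < K := by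
        have h1 : 0 < β.scale 0 := hβ.2.2.2.2
        positivity
      positivity
    · filter_upwards [hodd, hm.eventually_gt_atTop 0] with n hn hmn0
      refine (measure_lt_supError_le hβ hf σ hfsum hk hs2 (hεlaw n) (hεind n) hmn0 (hmn n hn)
        (hβhat n hn) hτ0).trans (ENNReal.ofReal_le_ofReal ?_)
      rw [div_le_iff₀ hτ0, hτ, mul_add, mul_div_cancel₀ _ hδ.ne']
      linarith
  · obtain ⟨D, hD⟩ := exists_rate_le_of_isTheta hΘ
    refine ⟨2 * Real.pi * (K * K₁ + A) * D, ?_⟩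
    filter_upwards [hmise, hD] with n h1 h2
    refine h1.trans (ENNReal.ofReal_le_ofReal ?_)
    rw [mul_assoc _ D]
    exact mul_le_mul_of_nonneg_left h2 hC0
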